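/- **Terms.** Fix sets of identifiers, role names, functions, labels, run identifiers, agents (some of them trusted) and a nonempty set $\mathcal I$ of intruder-generated terms. Role terms are built from identifiers and role names by functions $f(x_1,\dots,x_n)$, pairing and encryption $\{x\}_y$. Run terms are built in the same way from agents and nonce run terms, which are the $x\sharp rid$ ($x$ an identifier, $rid$ a run identifier) and the elements of $\mathcal I$. The subterm relation $\sqsubseteq$ passes through pairs, encryption bodies and encryption keys, not through function arguments. Each function symbol has an inverse symbol, by an involution; the inverse key is $f(\vec t)^{-1}=f^{-1}(\vec t)$, and $t^{-1}=t$ for other run terms. Functions build only long-term keys: no identifier occurs in their arguments. **Protocols.** Events are $\mathrm{create}_\ell(r)$, $\mathrm{send}_\ell(r,r',x)$ (executed by $r$), $\mathrm{read}_\ell(r',r,x)$ (executed by $r$, sent by $r'$), $\mathrm{claim}_\ell(r,cl[,x])$ and $\mathrm{end}_\ell(r)$. A role specification for $r$ is a list of events executed by $r$, starting with its only create event and ending with its only end event, together with a partial function typing identifiers as constants, variables or parameters, defined on all identifiers that appear in the list. A protocol is a partial map from role names to role specifications; its labels are unique, except that corresponding send and read events share one. In a protocol set no label occurs in two protocols;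 $\ell\in\Pi$ means that $\ell$ labels an event of a protocol in $\Pi$. **Traces.** An instantiation $inst=(rid,\rho,\sigma)$ consists of a run identifier, a partial map $\rho$ from roles to agents and a partial map $\sigma$ from identifiers to nonce run terms. It maps a constant $x$ to $x\sharp rid$, a variable or parameter to its value under $\sigma$, a role to its agent under $\rho$, and is extended homomorphically. The initial intruder knowledge, the same for all protocol sets, is the intruder closure of all agents, $\mathcal I$ and a fixed set $K_0$ of long-term keys (run terms $f(\vec t)$). Closure is under pairing, projection, encryption, and decryption (from $\{u\}_v$ and $v^{-1}$ infer $u$). $\mathrm{Tr}(\Pi)$ is the set of finite sequences of run events $(inst,ev)$ generated as follows. A run of a role of $P\in\Pi$ is created with an unused run identifier, with $\rho$ defined exactly on the roles of $P$, and with $\sigma$ giving arbitrary values to exactly the parameters; it then executes its events in order. A send adds the instantiated message to the intruder knowledge and closes; a read extends $\sigma$ to the free variables of its pattern so that the instantiated pattern is known to the intruder; create, claim and end events leave the intruder knowledge unchanged. **Secrecy and independence.** For a set $T$ of traces and the label $\ell$ of a secrecy claim, $T\models\ell$ means: for every $\alpha\in T$ and every event $(inst,\mathrm{claim}_\ell(r,\mathrm{secret},m))$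 in $\alpha$ whose $\rho$ has only trusted agents in its image, $inst(m)$ is not in the intruder knowledge after $\alpha$. Disjoint protocol sets $\Pi,\Pi'$ are *independent* under a trace restriction $\chi$ if, for every $\alpha\in\mathrm{Tr}(\Pi\cup\Pi')$ with $\chi(\alpha)$: whenever $\alpha$ contains a send event with label $\ell$, message $m$ and instantiation $inst$, and a send, read or claim event with label $\ell'$, message or argument $m'$ and instantiation $inst'$, and $\{x\}_y\sqsubseteq m$, $\{x'\}_{y'}\sqsubseteq m'$, $inst(\{x\}_y)=inst'(\{x'\}_{y'})$, then $\ell,\ell'\in\Pi$ or $\ell,\ell'\in\Pi'$. **Passing.** Let $\Pi_1\cup\Pi_2$ be a protocol set in which messages use secret long-term keys only as keys: every function term that occurs in a sent or read message outside encryption keys has only instances in $K_0$. Let $\emptyset\ne\Pi_1'\subseteq\Pi_1$ be such that every protocol of $\Pi_1'$ establishes $c$ (in every trace of a protocol set containing it, $c$ has a value at each of its end events) and has two distinct roles $r_0,r_1$. Let $\Pi_2'\subseteq\Pi_2$ be such that $d$ is a parameter in every role of every protocol of $\Pi_2'$, and $\Pi_2$ has no other parameters ($d$ in protocols of $\Pi_2'$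 is the only one). All protocols in $\Pi_1'\cup\Pi_2'$ have the same roles. * $\Pi_1^{\mathrm{reveal}(c)}$ arises from $\Pi_1$ by inserting, in each role $r$ of each protocol of $\Pi_1'$, just before the end event, a freshly labelled event $\mathrm{send}(r,\nu(r),c)$, where $\nu(r)=r_0$ if $r\ne r_0$ and $\nu(r_0)=r_1$ ($r_0,r_1$ may depend on the protocol). Freshness means that $\Pi_1^{\mathrm{reveal}(c)}\cup\Pi_2$ is again a protocol set. * $\chi_{adv}(\alpha)$: at every create event of $\Pi_2'$ in $\alpha$, the value of $d$ is in the intruder knowledge right before that event. * $\chi_{IO}(\alpha)$: for every create event $\alpha_i=(inst_i,\mathrm{create}(r))$ of $\Pi_2'$ there is an end event $\alpha_j=(inst_j,\mathrm{end}(r))$ of the same role $r$ in a protocol of $\Pi_1'$, with $inst_j(c)=inst_i(d)$ and $\rho_j=\rho_i$, such that $j<k$ for every create event $\alpha_k$ of $\Pi_2'$ with $inst_k(d)=inst_i(d)$ and $\rho_k=\rho_i$. **Theorem.** Suppose that $\Pi_1^{\mathrm{reveal}(c)}$ and $\Pi_2$ are independent under $\chi_{adv}$, and let $\ell$ be the label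 of a secrecy claim event in $\Pi_1$. If $\mathrm{Tr}(\Pi_1^{\mathrm{reveal}(c)})\models\ell$, then $\{\alpha\in\mathrm{Tr}(\Pi_1\cup\Pi_2)\mid\chi_{IO}(\alpha)\}\models\ell$. -/

import Mathlib

universe u

namespace ProtComp

/-- The basic sets over which protocols and their executions are built.  `inv` sends the function
symbol of an asymmetric long-term key to the symbol of its inverse (and fixes the symbols of
symmetric keys). -/
structure Signature where
  Id : Type u
  Role : Type u
  Func : Type u
  Label : Type u
  RunId : Type u
  Intruder : Type u
  Agent : Type u
  trusted : Set Agent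
  inv : Func → Func
  inv_inv : ∀ f, inv (inv f) = f

inductive IdKind
  | const
  | param
  | var

/-- The claims that may be made about a trace. -/
inductive Claim
  | secret
  | sessionUnique
  | dataAgree
  | session
  | weakSession
  | niSynch
  | iSynch

/-! ### Role terms -/

inductive RoleTerm (S : Signature.{u}) : Type u
  | id : S.Id → RoleTerm S
  | role : S.Role → RoleTerm S
  | fn : S.Func → (n : ℕ) → (Fin n → RoleTerm S) → RoleTerm S
  | pair : RoleTerm S → RoleTerm S → RoleTerm S
  | enc : RoleTerm S → RoleTerm S → RoleTerm S

variable {S : Signature.{u}}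

/-- `Subterm x y`: `x ⊑ y`.  Arguments of functions are not subterms, encryption keys are. -/
inductive RoleTerm.Subterm (x : RoleTerm S) : RoleTerm S → Prop
  | refl : RoleTerm.Subterm x x
  | pairLeft (a b : RoleTerm S) : RoleTerm.Subterm x a → RoleTerm.Subterm x (.pair a b)
  | pairRight (a b : RoleTerm S) : RoleTerm.Subterm x b → RoleTerm.Subterm x (.pair a b)
  | encBody (a b : RoleTerm S) : RoleTerm.Subterm x a → RoleTerm.Subterm x (.enc a b)
  | encKey (a b : RoleTerm S) : RoleTerm.Subterm x b → RoleTerm.Subterm x (.enc a b)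

/-- `Content x y`: `x` occurs in `y` as content, that is, not inside an encryption key. -/
inductive RoleTerm.Content (x : RoleTerm S) : RoleTerm S → Prop
  | refl : RoleTerm.Content x x
  | pairLeft (a b : RoleTerm S) : RoleTerm.Content x a → RoleTerm.Content x (.pair a b)
  | pairRight (a b : RoleTerm S) : RoleTerm.Content x b → RoleTerm.Content x (.pair a b)
  | encBody (a b : RoleTerm S) : RoleTerm.Content x a → RoleTerm.Content x (.enc a b)

/-- The identifiers that appear in a role term. -/
def RoleTerm.ids : RoleTerm S → Set S.Id
  | .id x => {x}
  | .role _ => ∅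
  | .fn _ _ args => ⋃ i, (args i).ids
  | .pair a b => a.ids ∪ b.ids
  | .enc a b => a.ids ∪ b.ids

/-! ### Events, role specifications, protocols -/

/-- Both `send l a b x` and `read l a b x` concern a message from role `a` to role `b`; `finish` is the
end event of a role. -/
inductive Event (S : Signature.{u}) : Type u
  | create : S.Label → S.Role → Event S
  | send : S.Label → S.Role → S.Role → RoleTerm S → Event S
  | read : S.Label → S.Role → S.Role → RoleTerm S → Event S
  | claim : S.Label → S.Role → Claim → Option (RoleTerm S) → Event S
  | finish : S.Label → S.Role → Event S

def Event.label : Event S → S.Label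
  | .create l _ => l
  | .send l _ _ _ => l
  | .read l _ _ _ => l
  | .claim l _ _ _ => l
  | .finish l _ => l

/-- The role that executes the event. -/
def Event.actor : Event S → S.Role
  | .create _ r => r
  | .send _ a _ _ => a
  | .read _ _ b _ => b
  | .claim _ r _ _ => r
  | .finish _ r => r

/-- The message of a send or read event. -/
def Event.message : Event S → Option (RoleTerm S)
  | .send _ _ _ x => some x
  | .read _ _ _ x => some x
  | _ => none

/-- The message of a send or read event, or the argument of a claim event. -/
def Event.term : Event S → Option (RoleTerm S)
  | .send _ _ _ x => some x
  | .read _ _ _ x => some x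
  | .claim _ _ _ x => x
  | _ => none

def Event.IsCreateOrFinish : Event S → Prop
  | .create _ _ => True
  | .finish _ _ => True
  | _ => False

structure RoleSpec (S : Signature.{u}) : Type u where
  elist : List (Event S)
  typ : S.Id → Option IdKind

/-- The requirements on a role specification with role name `r`. -/
structure RoleSpec.WellFormed (rs : RoleSpec S) (r : S.Role) : Prop where
  shape : ∃ (l l' : S.Label) (mid : List (Event S)),
    rs.elist = .create l r :: (mid ++ [.finish l' r]) ∧ ∀ e ∈ mid, ¬ e.IsCreateOrFinish
  actor_eq : ∀ e ∈ rs.elist, e.actor = r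
  typed : ∀ e ∈ rs.elist, ∀ m, e.term = some m → ∀ x ∈ m.ids, rs.typ x ≠ none

abbrev Protocol (S : Signature.{u}) : Type u := S.Role → Option (RoleSpec S)

/-- The roles of a protocol. -/
def Protocol.roles (P : Protocol S) : Set S.Role := {r | P r ≠ none}

/-- `e` and `e'` are a send event and a read event that correspond to each other. -/
def Event.Corresponding (e e' : Event S) : Prop :=
  ∃ l a b x y, e = .send l a b x ∧ e' = .read l a b y

/-- The labels of the events of a protocol. -/
def Protocol.labels (P : Protocol S) : Set S.Label :=
  {l | ∃ r rs, P r = some rs ∧ ∃ e ∈ rs.elist, e.label = l}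

structure Protocol.WellFormed (P : Protocol S) : Prop where
  specs : ∀ r rs, P r = some rs → rs.WellFormed r
  labels_unique : ∀ (r r' : S.Role) (rs rs' : RoleSpec S) (k k' : ℕ) (e e' : Event S),
    P r = some rs → P r' = some rs' → rs.elist[k]? = some e → rs'.elist[k']? = some e' →
    e.label = e'.label →
    (r = r' ∧ k = k') ∨ e.Corresponding e' ∨ e'.Corresponding e

/-- The labels used in a set of protocols. -/
def labels (Ps : Set (Protocol S)) : Set S.Label := ⋃ P ∈ Ps, P.labels

/-- The requirements on a protocol set: its members are well-formed protocols, and no label is used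
in two of them. -/
structure IsProtocolSet (Ps : Set (Protocol S)) : Prop where
  wellFormed : ∀ P ∈ Ps, P.WellFormed
  labels_disjoint : ∀ P ∈ Ps, ∀ Q ∈ Ps, ∀ l ∈ P.labels, l ∈ Q.labels → P = Q

/-! ### Run terms -/

/-- Nonce run terms: `x♯rid`, and the intruder-generated terms. -/
inductive Nonce (S : Signature.{u}) : Type u
  | fresh : S.Id → S.RunId → Nonce S
  | intruder : S.Intruder → Nonce S

inductive RunTerm (S : Signature.{u}) : Type u
  | agent : S.Agent → RunTerm S
  | nonce : Nonce S → RunTerm S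
  | fn : S.Func → (n : ℕ) → (Fin n → RunTerm S) → RunTerm S
  | pair : RunTerm S → RunTerm S → RunTerm S
  | enc : RunTerm S → RunTerm S → RunTerm S

/-- The inverse of a term used as a key: the inverse key for a long-term key, and the term itself
otherwise (symmetric encryption). -/
def RunTerm.inv : RunTerm S → RunTerm S
  | .fn f n args => .fn (S.inv f) n args
  | t => t

/-- The smallest superset of `A` that is closed under the rules of the intruder. -/
inductive Closure (A : Set (RunTerm S)) : RunTerm S → Prop
  | mem (t : RunTerm S) : t ∈ A → Closure A t
  | enc (u v : RunTerm S) : Closure A u → Closure A v → Closure A (.enc u v)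
  | dec (u v : RunTerm S) : Closure A (.enc u v) → Closure A v.inv → Closure A u
  | pair (u v : RunTerm S) : Closure A u → Closure A v → Closure A (.pair u v)
  | fst (u v : RunTerm S) : Closure A (.pair u v) → Closure A u
  | snd (u v : RunTerm S) : Closure A (.pair u v) → Closure A v

def intruderClosure (A : Set (RunTerm S)) : Set (RunTerm S) := {t | Closure A t}

/-- A long-term key, that is, a run term of the form `f(t₁, …, tₙ)`. -/
structure LongTermKey (S : Signature.{u}) : Type u where
  func : S.Func
  arity : ℕ
  args : Fin arity → RunTerm S

def LongTermKey.toTerm (k : LongTermKey S) : RunTerm S := .fn k.func k.arity k.args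

/-- The initial intruder knowledge: what can be derived from the agent names, the
intruder-generated terms and the set `K₀` of long-term keys that the intruder knows from the start
(such as all public keys, and the secret keys of compromised agents). -/
def initialKnowledge (K₀ : Set (LongTermKey S)) : Set (RunTerm S) :=
  intruderClosure (Set.range RunTerm.agent ∪
    Set.range (fun i => RunTerm.nonce (Nonce.intruder i)) ∪
    LongTermKey.toTerm '' K₀)

/-! ### Instantiations -/

/-- Instantiations `(rid, ρ, σ)`; only nonce run terms are assigned to identifiers. -/
structure Inst (S : Signature.{u}) : Type u where
  rid : S.RunId
  ρ : S.Role → Option S.Agent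
  σ : S.Id → Option (Nonce S)

open Classical in
/-- `inst(x)` in the context of a type function; `none` if `inst` cannot be applied to `x`. -/
noncomputable def Inst.apply (typ : S.Id → Option IdKind) (inst : Inst S) :
    RoleTerm S → Option (RunTerm S)
  | .id x =>
    match typ x with
    | some .const => some (.nonce (.fresh x inst.rid))
    | some .param => (inst.σ x).map .nonce
    | some .var => (inst.σ x).map .nonce
    | none => none
  | .role r => (inst.ρ r).map .agent
  | .fn f n args =>
    if h : ∀ i, (inst.apply typ (args i)).isSome then
      some (.fn f n fun i => (inst.apply typ (args i)).get (h i))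
    else none
  | .pair a b => Option.map₂ .pair (inst.apply typ a) (inst.apply typ b)
  | .enc a b => Option.map₂ .enc (inst.apply typ a) (inst.apply typ b)

/-- The variables of a role term in the context of a type function. -/
def RoleTerm.vars (typ : S.Id → Option IdKind) (m : RoleTerm S) : Set S.Id :=
  {x | x ∈ m.ids ∧ typ x = some .var}

/-- The match predicate: `inst'` extends `inst` by values for the free variables of the pattern `m`
so that the pattern becomes the message `t`. -/
def Match (typ : S.Id → Option IdKind) (inst : Inst S) (m : RoleTerm S) (t : RunTerm S)
    (inst' : Inst S) : Prop :=
  inst'.rid = inst.rid ∧ inst'.ρ = inst.ρ ∧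
  (∀ x v, inst.σ x = some v → inst'.σ x = some v) ∧
  {x | inst'.σ x ≠ none} = {x | inst.σ x ≠ none} ∪ m.vars typ ∧
  inst'.apply typ m = some t

/-! ### Runs, transitions and traces -/

/-- A run, together with the role specification that it executes; `rest` lists the events still to
be executed. -/
structure Run (S : Signature.{u}) : Type u where
  spec : RoleSpec S
  inst : Inst S
  rest : List (Event S)

/-- A run event `(inst, ev)`, together with the role specification in whose context it is read. -/
structure RunEvent (S : Signature.{u}) : Type u where
  spec : RoleSpec S
  inst : Inst S
  ev : Event S

abbrev Trace (S : Signature.{u}) : Type u := List (RunEvent S)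

/-- The value of an identifier in the instantiation of a run event. -/
noncomputable def RunEvent.value (e : RunEvent S) (x : S.Id) : Option (RunTerm S) :=
  e.inst.apply e.spec.typ (.id x)

/-- The initial runs of a protocol set. -/
def initialRuns (Ps : Set (Protocol S)) : Set (Run S) :=
  {R | ∃ P ∈ Ps, ∃ r, P r = some R.spec ∧ R.rest = R.spec.elist ∧
    {r' | R.inst.ρ r' ≠ none} = P.roles ∧
    {x | R.inst.σ x ≠ none} = {x | R.spec.typ x = some .param}}

/-- System states: the intruder knowledge and the set of active runs. -/
structure State (S : Signature.{u}) : Type u where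
  IK : Set (RunTerm S)
  F : Set (Run S)

/-- `F[x/y]`. -/
def replaceRun (F : Set (Run S)) (x y : Run S) : Set (Run S) := insert x (F \ {y})

inductive Step (Ps : Set (Protocol S)) : State S → RunEvent S → State S → Prop
  | create (IK : Set (RunTerm S)) (F : Set (Run S)) (rs : RoleSpec S) (inst : Inst S)
      (l : S.Label) (r : S.Role) (rest : List (Event S)) :
      (⟨rs, inst, .create l r :: rest⟩ : Run S) ∈ initialRuns Ps →
      (∀ R ∈ F, R.inst.rid ≠ inst.rid) →
      Step Ps ⟨IK, F⟩ ⟨rs, inst, .create l r⟩ ⟨IK, insert ⟨rs, inst, rest⟩ F⟩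
  | finish (IK : Set (RunTerm S)) (F : Set (Run S)) (rs : RoleSpec S) (inst : Inst S)
      (l : S.Label) (r : S.Role) :
      (⟨rs, inst, [.finish l r]⟩ : Run S) ∈ F →
      Step Ps ⟨IK, F⟩ ⟨rs, inst, .finish l r⟩
        ⟨IK, replaceRun F ⟨rs, inst, []⟩ ⟨rs, inst, [.finish l r]⟩⟩
  | send (IK : Set (RunTerm S)) (F : Set (Run S)) (rs : RoleSpec S) (inst : Inst S)
      (l : S.Label) (a b : S.Role) (m : RoleTerm S) (rest : List (Event S)) (t : RunTerm S) :
      (⟨rs, inst, .send l a b m :: rest⟩ : Run S) ∈ F →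
      inst.apply rs.typ m = some t →
      Step Ps ⟨IK, F⟩ ⟨rs, inst, .send l a b m⟩
        ⟨intruderClosure (insert t IK),
          replaceRun F ⟨rs, inst, rest⟩ ⟨rs, inst, .send l a b m :: rest⟩⟩
  | read (IK : Set (RunTerm S)) (F : Set (Run S)) (rs : RoleSpec S) (inst inst' : Inst S)
      (l : S.Label) (a b : S.Role) (m : RoleTerm S) (rest : List (Event S)) (t : RunTerm S) :
      (⟨rs, inst, .read l a b m :: rest⟩ : Run S) ∈ F →
      t ∈ IK →
      Match rs.typ inst m t inst' →
      Step Ps ⟨IK, F⟩ ⟨rs, inst', .read l a b m⟩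
        ⟨IK, replaceRun F ⟨rs, inst', rest⟩ ⟨rs, inst, .read l a b m :: rest⟩⟩
  | claim (IK : Set (RunTerm S)) (F : Set (Run S)) (rs : RoleSpec S) (inst : Inst S)
      (l : S.Label) (r : S.Role) (cl : Claim) (x : Option (RoleTerm S)) (rest : List (Event S)) :
      (⟨rs, inst, .claim l r cl x :: rest⟩ : Run S) ∈ F →
      Step Ps ⟨IK, F⟩ ⟨rs, inst, .claim l r cl x⟩
        ⟨IK, replaceRun F ⟨rs, inst, rest⟩ ⟨rs, inst, .claim l r cl x :: rest⟩⟩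

inductive Derivation (Ps : Set (Protocol S)) : State S → Trace S → State S → Prop
  | nil (s : State S) : Derivation Ps s [] s
  | cons (s s' s'' : State S) (e : RunEvent S) (α : Trace S) :
      Step Ps s e s' → Derivation Ps s' α s'' → Derivation Ps s (e :: α) s''

/-- The valid traces of a protocol set. -/
def traces (K₀ : Set (LongTermKey S)) (Ps : Set (Protocol S)) : Set (Trace S) :=
  {α | ∃ s, Derivation Ps ⟨initialKnowledge K₀, ∅⟩ α s}

/-- The traces that satisfy a trace restriction. -/
def restrictedTraces (K₀ : Set (LongTermKey S)) (Ps : Set (Protocol S)) (χ : Trace S → Prop) :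
    Set (Trace S) :=
  {α | α ∈ traces K₀ Ps ∧ χ α}

/-- The intruder knowledge after one more run event. -/
def nextKnowledge (IK : Set (RunTerm S)) (e : RunEvent S) : Set (RunTerm S) :=
  match e.ev with
  | .send _ _ _ m => intruderClosure (IK ∪ {t | e.inst.apply e.spec.typ m = some t})
  | _ => IK

/-- The intruder knowledge after the run events of `α`.  The knowledge right before the `i`-th
event of `α` is `knowledge K₀ (α.take i)`. -/
def knowledge (K₀ : Set (LongTermKey S)) (α : Trace S) : Set (RunTerm S) :=
  α.foldl nextKnowledge (initialKnowledge K₀)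

/-! ### Passing of parameters -/

/-- In every trace, `c` has a value whenever a run of a role of `P` ends. -/
def Establishes (K₀ : Set (LongTermKey S)) (P : Protocol S) (c : S.Id) : Prop :=
  ∀ Ps : Set (Protocol S), IsProtocolSet Ps → P ∈ Ps → ∀ α ∈ traces K₀ Ps, ∀ e ∈ α,
    ∀ l r, e.ev = .finish l r → l ∈ P.labels → e.value c ≠ none

/-- `d` is a parameter in every role of `P`. -/
def HasParam (P : Protocol S) (d : S.Id) : Prop :=
  ∀ r rs, P r = some rs → rs.typ d = some .param

def RunEvent.IsCreateOf (e : RunEvent S) (Ps : Set (Protocol S)) : Prop :=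
  ∃ l r, e.ev = .create l r ∧ l ∈ labels Ps

/-- The indices in `α` of the create events of protocols in `Ps` that get the same input `d`, and
have the same assignment of agents to roles, as the create event `e` (the set `A'` of `e`). -/
def sameInput (α : Trace S) (Ps : Set (Protocol S)) (d : S.Id) (e : RunEvent S) : Set ℕ :=
  {j | ∃ e', α[j]? = some e' ∧ e'.IsCreateOf Ps ∧ e'.value d = e.value d ∧
    ∀ r, e'.inst.ρ r = e.inst.ρ r}

/-- The indices in `α` of the end events, of the role of `e` in protocols in `Ps`, at which `c` has
the value that the create event `e` gets as input `d`, with the same assignment of agents to roles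
as `e` (the set `B'` of `e`). -/
def possibleSources (α : Trace S) (Ps : Set (Protocol S)) (c d : S.Id) (e : RunEvent S) : Set ℕ :=
  {j | ∃ e', α[j]? = some e' ∧ (∃ l, e'.ev = .finish l e.ev.actor ∧ l ∈ labels Ps) ∧
    (∃ t, e'.value c = some t ∧ e.value d = some t) ∧ ∀ r, e'.inst.ρ r = e.inst.ρ r}

/-- The protocols in `Qs` take as input `d` values that were recorded earlier in `c` by the
corresponding role of the protocols in `Ps`. -/
def chiIO (Ps Qs : Set (Protocol S)) (c d : S.Id) (α : Trace S) : Prop :=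
  ∀ (i : ℕ) (e : RunEvent S), α[i]? = some e → e.IsCreateOf Qs →
    ∃ j ∈ possibleSources α Ps c d e, ∀ k ∈ sameInput α Qs d e, j < k

/-- The protocols in `Qs` get their input `d` from the adversary. -/
def chiAdversary (K₀ : Set (LongTermKey S)) (Qs : Set (Protocol S)) (d : S.Id) (α : Trace S) :
    Prop :=
  ∀ (i : ℕ) (e : RunEvent S), α[i]? = some e → e.IsCreateOf Qs →
    ∃ t, e.value d = some t ∧ t ∈ knowledge K₀ (α.take i)

open Classical in
/-- The role specification of role `r` with the event `send_l(r, ν(r), c)` inserted before its end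
event, where `ν(r)` is `r₀` if `r ≠ r₀`, and `r₁` otherwise. -/
noncomputable def RoleSpec.reveal (rs : RoleSpec S) (c : S.Id) (r r₀ r₁ : S.Role) (l : S.Label) :
    RoleSpec S where
  elist := rs.elist.dropLast ++ .send l r (if r ≠ r₀ then r₀ else r₁) (.id c) ::
    rs.elist.getLast?.toList
  typ := rs.typ

/-- The protocol `P` extended to reveal `c`; `lab` labels the new send events. -/
noncomputable def Protocol.reveal (P : Protocol S) (c : S.Id) (r₀ r₁ : S.Role)
    (lab : S.Role → S.Label) : Protocol S :=
  fun r => (P r).map fun rs => rs.reveal c r r₀ r₁ (lab r)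

/-- The protocol set `Ps`, with each protocol in the subset `Out` extended to reveal `c`. -/
noncomputable def revealSet (Ps Out : Set (Protocol S)) (c : S.Id) (r₀ r₁ : Protocol S → S.Role)
    (lab : Protocol S → S.Role → S.Label) : Set (Protocol S) :=
  (fun P => P.reveal c (r₀ P) (r₁ P) (lab P)) '' Out ∪ (Ps \ Out)

/-! ### Use of long-term keys, independence, secrecy -/

/-- Functions only build long-term keys (their arguments contain no identifiers), and in messages,
secret long-term keys occur only as keys: a function term that occurs as content has only instances
that the intruder knows from the start. -/
def UsesSecretKeysOnlyAsKeys (K₀ : Set (LongTermKey S)) (P : Protocol S) : Prop :=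
  ∀ r rs, P r = some rs → ∀ e ∈ rs.elist, ∀ f n args,
    (∀ m, e.term = some m → (RoleTerm.fn f n args).Subterm m →
      (RoleTerm.fn f n args).ids = ∅) ∧
    (∀ m, e.message = some m → (RoleTerm.fn f n args).Content m →
      ∀ (inst : Inst S) (t : RunTerm S), inst.apply rs.typ (.fn f n args) = some t →
        ∃ k ∈ K₀, t = k.toTerm)

def Event.IsSend : Event S → Prop
  | .send _ _ _ _ => True
  | _ => False

/-- `Ps` and `Qs` are independent in the context of `χ`: no encryption sent by one of them occurs
in a read, send or claim event of the other. -/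
def Independent (K₀ : Set (LongTermKey S)) (Ps Qs : Set (Protocol S)) (χ : Trace S → Prop) :
    Prop :=
  Disjoint Ps Qs ∧
  ∀ α ∈ restrictedTraces K₀ (Ps ∪ Qs) χ, ∀ e ∈ α, ∀ e' ∈ α, ∀ (m m' x y x' y' : RoleTerm S)
    (t : RunTerm S),
    e.ev.IsSend → e.ev.term = some m → e'.ev.term = some m' →
    (RoleTerm.enc x y).Subterm m → (RoleTerm.enc x' y').Subterm m' →
    e.inst.apply e.spec.typ (.enc x y) = some t →
    e'.inst.apply e'.spec.typ (.enc x' y') = some t →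
    (e.ev.label ∈ labels Ps ∧ e'.ev.label ∈ labels Ps) ∨
      (e.ev.label ∈ labels Qs ∧ e'.ev.label ∈ labels Qs)

/-- `l` is the label of a secrecy claim event of the protocol set. -/
def IsSecretClaimLabel (Ps : Set (Protocol S)) (l : S.Label) : Prop :=
  ∃ P ∈ Ps, ∃ r rs, P r = some rs ∧ ∃ r' m, Event.claim l r' .secret (some m) ∈ rs.elist

/-- The restricted trace set of `Ps` satisfies the secrecy claim with label `l`: whenever the claim
event occurs in a run all of whose agents are trusted, the intruder does not learn its argument in
the whole trace. -/
def SatisfiesSecret (K₀ : Set (LongTermKey S)) (Ps : Set (Protocol S)) (χ : Trace S → Prop)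
    (l : S.Label) : Prop :=
  ∀ α ∈ restrictedTraces K₀ Ps χ, ∀ e ∈ α, ∀ r m, e.ev = .claim l r .secret (some m) →
    (∀ t, e.inst.apply e.spec.typ m = some t → t ∉ knowledge K₀ α) ∨
      ¬ {a | ∃ r', e.inst.ρ r' = some a} ⊆ S.trusted

end ProtComp

open ProtComp

namespace ProtComp

variable {S : Signature.{u}}

/-! ### Intruder closure -/

/-! A violation of secrecy in a trace of both protocol sets is turned into a violation in a trace of
the revealing version of the first set alone, by two transformations of traces.

Adding reveals. Every run of an output protocol is made to send `c` immediately before its end event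
(`expandTrace`). The send can be executed because these protocols establish `c`, and all reads
remain possible because the intruder only learns more (`Derivation.expand`). Under `chiIO`, an input
`d` was the value of `c` at an end event before the create event that takes it, so it has now been
sent and is known to the intruder: the new trace satisfies `chiAdversary`
(`chiAdversary_expandTrace`), and independence applies to it.

Removing the second set. Let `N` be the identifiers of the runs of the second set. Its runs are
deleted, and each nonce that they generate is replaced by one intruder term `i`; the intruder has to
supply what these runs contributed. This is measured by `RunTerm.collapse`, which also replaces
every encryption sent as content by a run in `N` by `i`. Two invariants support each other: (a) each
value held by a run in `N` is, after renaming, known in the projected trace (`KnownValues`); (b) the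
collapse of every term known in the full trace is known in the projected trace
(`KnownValues.collapse_mem`). For (b), the critical case is decryption of an encryption sent by `N`:
its collapse `i` has no body to extract, but the body is content of a message of `N`, and all such
content is known by (a) and because secret long-term keys are sent only as keys. For (a), inputs are
known by `chiAdversary`, and a value bound by a read is a nonce in a derivable message that shares
no encryption with the sends outside `N`; such a message was assembled by the intruder from known
parts and encryptions sent by `N` (`KnownValues.subterm_nonce`).

By independence, messages and claim arguments outside `N` contain no encryption sent by `N`, so for
them collapsing is mere renaming. Hence the projected runs can still read their messages
(`Derivation.project`), and a claimed secret known in the full trace is known, renamed, in the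
projected one. -/

theorem Closure.mono {A B : Set (RunTerm S)} (h : A ⊆ intruderClosure B) {t : RunTerm S}
    (ht : Closure A t) : Closure B t := by
  induction ht with
  | mem t h' => exact h h'
  | enc u v _ _ h₁ h₂ => exact .enc u v h₁ h₂
  | dec u v _ _ h₁ h₂ => exact .dec u v h₁ h₂
  | pair u v _ _ h₁ h₂ => exact .pair u v h₁ h₂
  | fst u v _ h₁ => exact .fst u v h₁
  | snd u v _ h₁ => exact .snd u v h₁

theorem subset_intruderClosure (A : Set (RunTerm S)) : A ⊆ intruderClosure A :=
  fun t h => .mem t h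

theorem intruderClosure_union_intruderClosure (A B : Set (RunTerm S)) :
    intruderClosure (intruderClosure A ∪ B) = intruderClosure (A ∪ B) := by
  ext t
  constructor
  · refine Closure.mono ?_
    rintro t (h | h)
    · exact Closure.mono (fun x hx => .mem x (Or.inl hx)) h
    · exact .mem t (Or.inr h)
  · refine Closure.mono ?_
    rintro t (h | h)
    · exact .mem t (Or.inl (.mem t h))
    · exact .mem t (Or.inr h)

/-- The generators of the initial intruder knowledge. -/
def initialTerms (K₀ : Set (LongTermKey S)) : Set (RunTerm S) :=
  Set.range RunTerm.agent ∪ Set.range (fun i => RunTerm.nonce (Nonce.intruder i)) ∪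
    LongTermKey.toTerm '' K₀

/-- The instances of the messages that are sent in a trace. -/
def sentTerms (α : Trace S) : Set (RunTerm S) :=
  {t | ∃ e ∈ α, ∃ m, e.ev.IsSend ∧ e.ev.term = some m ∧ e.inst.apply e.spec.typ m = some t}

theorem sentTerms_append (α β : Trace S) : sentTerms (α ++ β) = sentTerms α ∪ sentTerms β := by
  ext t
  simp only [sentTerms, List.mem_append, Set.mem_union, Set.mem_ofPred_eq, or_and_right, exists_or]

theorem nextKnowledge_eq (A : Set (RunTerm S)) (e : RunEvent S) :
    nextKnowledge (intruderClosure A) e = intruderClosure (A ∪ sentTerms [e]) := by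
  obtain ⟨rs, inst, ev⟩ := e
  cases ev <;>
    simp [nextKnowledge, sentTerms, Event.IsSend, Event.term,
      intruderClosure_union_intruderClosure]

/-- Closing after every send gives the same set as closing once at the end. This form permits
induction on a single derivation from generators and shows that knowledge depends on the sent terms
only. -/
theorem knowledge_eq (K₀ : Set (LongTermKey S)) (α : Trace S) :
    knowledge K₀ α = intruderClosure (initialTerms K₀ ∪ sentTerms α) := by
  induction α using List.reverseRecOn with
  | nil => simp [knowledge, initialKnowledge, initialTerms, sentTerms]
  | append_singleton α e ih =>
    rw [knowledge, List.foldl_append, ← knowledge, ih, List.foldl_cons, List.foldl_nil,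
      nextKnowledge_eq, sentTerms_append, Set.union_assoc]

theorem knowledge_mono (K₀ : Set (LongTermKey S)) {α β : Trace S}
    (h : sentTerms α ⊆ sentTerms β) : knowledge K₀ α ⊆ knowledge K₀ β := by
  rw [knowledge_eq, knowledge_eq]
  exact fun t => Closure.mono
    ((Set.union_subset_union_right _ h).trans (subset_intruderClosure _))

theorem knowledge_mono_append (K₀ : Set (LongTermKey S)) (α β : Trace S) :
    knowledge K₀ α ⊆ knowledge K₀ (α ++ β) :=
  knowledge_mono K₀ (by rw [sentTerms_append]; exact Set.subset_union_left)

theorem initialTerms_subset_knowledge (K₀ : Set (LongTermKey S)) (α : Trace S) :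
    initialTerms K₀ ⊆ knowledge K₀ α := by
  rw [knowledge_eq]
  exact Set.subset_union_left.trans (subset_intruderClosure _)

theorem sentTerms_subset_knowledge (K₀ : Set (LongTermKey S)) (α : Trace S) :
    sentTerms α ⊆ knowledge K₀ α := by
  rw [knowledge_eq]
  exact Set.subset_union_right.trans (subset_intruderClosure _)

theorem intruder_mem_knowledge (K₀ : Set (LongTermKey S)) (α : Trace S) (i : S.Intruder) :
    RunTerm.nonce (.intruder i) ∈ knowledge K₀ α :=
  initialTerms_subset_knowledge K₀ α (Or.inl (Or.inr ⟨i, rfl⟩))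

theorem knowledge_snoc (K₀ : Set (LongTermKey S)) (α : Trace S) (e : RunEvent S) :
    knowledge K₀ (α ++ [e]) = nextKnowledge (knowledge K₀ α) e := by
  rw [knowledge, List.foldl_append]; rfl

theorem knowledge_snoc_of_not_isSend (K₀ : Set (LongTermKey S)) (α : Trace S) {e : RunEvent S}
    (h : ¬ e.ev.IsSend) : knowledge K₀ (α ++ [e]) = knowledge K₀ α := by
  rw [knowledge_snoc]
  obtain ⟨rs, inst, ev⟩ := e
  cases ev <;> simp_all [nextKnowledge, Event.IsSend]

theorem knowledge_snoc_send (K₀ : Set (LongTermKey S)) (α : Trace S) {rs : RoleSpec S}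
    {inst : Inst S} {l : S.Label} {a b : S.Role} {m : RoleTerm S} {t : RunTerm S}
    (h : inst.apply rs.typ m = some t) :
    knowledge K₀ (α ++ [⟨rs, inst, .send l a b m⟩]) =
      intruderClosure (insert t (knowledge K₀ α)) := by
  rw [knowledge_snoc]
  simp only [nextKnowledge, h, Option.some.injEq]
  congr 1
  ext x
  simp [eq_comm]

/-! ### Subterms of run terms -/

/-- The subterm relation on run terms; arguments of functions are not subterms. -/
inductive RunTerm.Subterm (x : RunTerm S) : RunTerm S → Prop
  | refl : RunTerm.Subterm x x
  | pairLeft (a b : RunTerm S) : RunTerm.Subterm x a → RunTerm.Subterm x (.pair a b)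
  | pairRight (a b : RunTerm S) : RunTerm.Subterm x b → RunTerm.Subterm x (.pair a b)
  | encBody (a b : RunTerm S) : RunTerm.Subterm x a → RunTerm.Subterm x (.enc a b)
  | encKey (a b : RunTerm S) : RunTerm.Subterm x b → RunTerm.Subterm x (.enc a b)

/-- Occurrence in a run term outside encryption keys. -/
inductive RunTerm.Content (x : RunTerm S) : RunTerm S → Prop
  | refl : RunTerm.Content x x
  | pairLeft (a b : RunTerm S) : RunTerm.Content x a → RunTerm.Content x (.pair a b)
  | pairRight (a b : RunTerm S) : RunTerm.Content x b → RunTerm.Content x (.pair a b)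
  | encBody (a b : RunTerm S) : RunTerm.Content x a → RunTerm.Content x (.enc a b)

theorem RunTerm.Content.subterm {x y : RunTerm S} (h : x.Content y) : x.Subterm y := by
  induction h with
  | refl => exact .refl
  | pairLeft a b _ ih => exact .pairLeft a b ih
  | pairRight a b _ ih => exact .pairRight a b ih
  | encBody a b _ ih => exact .encBody a b ih

theorem RunTerm.Subterm.trans {x y z : RunTerm S} (h : x.Subterm y) (h' : y.Subterm z) :
    x.Subterm z := by
  induction h' with
  | refl => exact h
  | pairLeft a b _ ih => exact .pairLeft a b ih
  | pairRight a b _ ih => exact .pairRight a b ih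
  | encBody a b _ ih => exact .encBody a b ih
  | encKey a b _ ih => exact .encKey a b ih

theorem RunTerm.Content.trans {x y z : RunTerm S} (h : x.Content y) (h' : y.Content z) :
    x.Content z := by
  induction h' with
  | refl => exact h
  | pairLeft a b _ ih => exact .pairLeft a b ih
  | pairRight a b _ ih => exact .pairRight a b ih
  | encBody a b _ ih => exact .encBody a b ih

/-- An encryption that occurs as content of a derivable term was built by the intruder, or occurs
as content of one of the generators. -/
theorem Closure.enc_content {A : Set (RunTerm S)} {t : RunTerm S} (ht : Closure A t)
    {u v : RunTerm S} (h : (RunTerm.enc u v).Content t) :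
    (∃ a ∈ A, (RunTerm.enc u v).Content a) ∨ (Closure A u ∧ Closure A v) := by
  induction ht with
  | mem t h' => exact Or.inl ⟨t, h', h⟩
  | enc u' v' h₁ h₂ ih₁ ih₂ =>
    cases h with
    | refl => exact Or.inr ⟨h₁, h₂⟩
    | encBody _ _ h => exact ih₁ h
  | dec u' v' _ _ ih₁ _ => exact ih₁ (.encBody _ _ h)
  | pair u' v' _ _ ih₁ ih₂ =>
    cases h with
    | pairLeft _ _ h => exact ih₁ h
    | pairRight _ _ h => exact ih₂ h
  | fst u' v' _ ih => exact ih (.pairLeft _ _ h)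
  | snd u' v' _ ih => exact ih (.pairRight _ _ h)

/-! ### Instances of role terms -/

theorem Inst.apply_pair_eq_some {typ : S.Id → Option IdKind} {inst : Inst S} {a b : RoleTerm S}
    {t : RunTerm S} : inst.apply typ (.pair a b) = some t ↔
      ∃ u v, inst.apply typ a = some u ∧ inst.apply typ b = some v ∧ .pair u v = t := by
  simp [Inst.apply, Option.map₂_eq_some_iff]

theorem Inst.apply_enc_eq_some {typ : S.Id → Option IdKind} {inst : Inst S} {a b : RoleTerm S}
    {t : RunTerm S} : inst.apply typ (.enc a b) = some t ↔
      ∃ u v, inst.apply typ a = some u ∧ inst.apply typ b = some v ∧ .enc u v = t := by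
  simp [Inst.apply, Option.map₂_eq_some_iff]

theorem Inst.apply_id_eq_some {typ : S.Id → Option IdKind} {inst : Inst S} {x : S.Id}
    {t : RunTerm S} (h : inst.apply typ (.id x) = some t) :
    (typ x = some .const ∧ t = .nonce (.fresh x inst.rid)) ∨
      ∃ n, inst.σ x = some n ∧ t = .nonce n := by
  unfold Inst.apply at h
  split at h <;> simp_all [eq_comm]

theorem Inst.apply_role_eq_some {typ : S.Id → Option IdKind} {inst : Inst S} {r : S.Role}
    {t : RunTerm S} (h : inst.apply typ (.role r) = some t) : ∃ a, t = .agent a := by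
  simp only [Inst.apply, Option.map_eq_some_iff] at h
  obtain ⟨a, -, rfl⟩ := h
  exact ⟨a, rfl⟩

theorem Inst.apply_fn_eq_some {typ : S.Id → Option IdKind} {inst : Inst S} {f : S.Func} {n : ℕ}
    {args : Fin n → RoleTerm S} {t : RunTerm S} (h : inst.apply typ (.fn f n args) = some t) :
    ∃ args', t = .fn f n args' := by
  unfold Inst.apply at h
  split at h
  · exact ⟨_, (Option.some.inj h).symm⟩
  · simp at h

theorem Inst.exists_of_apply_eq_pair {typ : S.Id → Option IdKind} {inst : Inst S}
    {m : RoleTerm S} {u v : RunTerm S} (h : inst.apply typ m = some (.pair u v)) :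
    ∃ x y, m = .pair x y ∧ inst.apply typ x = some u ∧ inst.apply typ y = some v := by
  cases m with
  | id x => rcases Inst.apply_id_eq_some h with ⟨_, h⟩ | ⟨_, _, h⟩ <;> cases h
  | role r => obtain ⟨_, h⟩ := Inst.apply_role_eq_some h; cases h
  | fn f n args => obtain ⟨_, h⟩ := Inst.apply_fn_eq_some h; cases h
  | pair x y =>
    obtain ⟨_, _, h₁, h₂, h⟩ := Inst.apply_pair_eq_some.1 h
    cases h
    exact ⟨x, y, rfl, h₁, h₂⟩
  | enc x y => obtain ⟨_, _, _, _, h⟩ := Inst.apply_enc_eq_some.1 h; cases h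

theorem Inst.exists_of_apply_eq_enc {typ : S.Id → Option IdKind} {inst : Inst S}
    {m : RoleTerm S} {u v : RunTerm S} (h : inst.apply typ m = some (.enc u v)) :
    ∃ x y, m = .enc x y ∧ inst.apply typ x = some u ∧ inst.apply typ y = some v := by
  cases m with
  | id x => rcases Inst.apply_id_eq_some h with ⟨_, h⟩ | ⟨_, _, h⟩ <;> cases h
  | role r => obtain ⟨_, h⟩ := Inst.apply_role_eq_some h; cases h
  | fn f n args => obtain ⟨_, h⟩ := Inst.apply_fn_eq_some h; cases h
  | pair x y => obtain ⟨_, _, _, _, h⟩ := Inst.apply_pair_eq_some.1 h; cases h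
  | enc x y =>
    obtain ⟨_, _, h₁, h₂, h⟩ := Inst.apply_enc_eq_some.1 h
    cases h
    exact ⟨x, y, rfl, h₁, h₂⟩

/-- Identifiers take only nonces as values, so every pair or encryption in an instance is already a
pair or encryption in the pattern. -/
theorem RunTerm.Content.exists_roleTerm {typ : S.Id → Option IdKind} {inst : Inst S}
    {w t : RunTerm S} (h : w.Content t) {m : RoleTerm S} (hm : inst.apply typ m = some t) :
    ∃ m', m'.Content m ∧ inst.apply typ m' = some w := by
  induction h generalizing m with
  | refl => exact ⟨m, .refl, hm⟩
  | pairLeft a b _ ih =>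
    obtain ⟨x, y, rfl, hx, -⟩ := Inst.exists_of_apply_eq_pair hm
    obtain ⟨m', h₁, h₂⟩ := ih hx
    exact ⟨m', .pairLeft _ _ h₁, h₂⟩
  | pairRight a b _ ih =>
    obtain ⟨x, y, rfl, -, hy⟩ := Inst.exists_of_apply_eq_pair hm
    obtain ⟨m', h₁, h₂⟩ := ih hy
    exact ⟨m', .pairRight _ _ h₁, h₂⟩
  | encBody a b _ ih =>
    obtain ⟨x, y, rfl, hx, -⟩ := Inst.exists_of_apply_eq_enc hm
    obtain ⟨m', h₁, h₂⟩ := ih hx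
    exact ⟨m', .encBody _ _ h₁, h₂⟩

theorem RunTerm.Subterm.exists_roleTerm {typ : S.Id → Option IdKind} {inst : Inst S}
    {w t : RunTerm S} (h : w.Subterm t) {m : RoleTerm S} (hm : inst.apply typ m = some t) :
    ∃ m', m'.Subterm m ∧ inst.apply typ m' = some w := by
  induction h generalizing m with
  | refl => exact ⟨m, .refl, hm⟩
  | pairLeft a b _ ih =>
    obtain ⟨x, y, rfl, hx, -⟩ := Inst.exists_of_apply_eq_pair hm
    obtain ⟨m', h₁, h₂⟩ := ih hx
    exact ⟨m', .pairLeft _ _ h₁, h₂⟩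
  | pairRight a b _ ih =>
    obtain ⟨x, y, rfl, -, hy⟩ := Inst.exists_of_apply_eq_pair hm
    obtain ⟨m', h₁, h₂⟩ := ih hy
    exact ⟨m', .pairRight _ _ h₁, h₂⟩
  | encBody a b _ ih =>
    obtain ⟨x, y, rfl, hx, -⟩ := Inst.exists_of_apply_eq_enc hm
    obtain ⟨m', h₁, h₂⟩ := ih hx
    exact ⟨m', .encBody _ _ h₁, h₂⟩
  | encKey a b _ ih =>
    obtain ⟨x, y, rfl, -, hy⟩ := Inst.exists_of_apply_eq_enc hm
    obtain ⟨m', h₁, h₂⟩ := ih hy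
    exact ⟨m', .encKey _ _ h₁, h₂⟩

/-- Independence speaks of encryption patterns; through this lemma it controls all encryptions in
the messages themselves. -/
theorem RunTerm.Subterm.exists_enc {typ : S.Id → Option IdKind} {inst : Inst S}
    {u v t : RunTerm S} (h : (RunTerm.enc u v).Subterm t) {m : RoleTerm S}
    (hm : inst.apply typ m = some t) :
    ∃ x y, (RoleTerm.enc x y).Subterm m ∧ inst.apply typ (.enc x y) = some (.enc u v) := by
  obtain ⟨m', h₁, h₂⟩ := h.exists_roleTerm hm
  obtain ⟨x, y, rfl, -, -⟩ := Inst.exists_of_apply_eq_enc h₂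
  exact ⟨x, y, h₁, h₂⟩

/-- No identifier occurs in an argument of a function in `m`. -/
def RoleTerm.GroundKeys (m : RoleTerm S) : Prop :=
  ∀ f n args, (RoleTerm.fn f n args).Subterm m → (RoleTerm.fn f n args).ids = ∅

theorem RoleTerm.GroundKeys.pair {a b : RoleTerm S} (h : (RoleTerm.pair a b).GroundKeys) :
    a.GroundKeys ∧ b.GroundKeys :=
  ⟨fun f n args h' => h f n args (.pairLeft _ _ h'),
    fun f n args h' => h f n args (.pairRight _ _ h')⟩

theorem RoleTerm.GroundKeys.enc {a b : RoleTerm S} (h : (RoleTerm.enc a b).GroundKeys) :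
    a.GroundKeys ∧ b.GroundKeys :=
  ⟨fun f n args h' => h f n args (.encBody _ _ h'),
    fun f n args h' => h f n args (.encKey _ _ h')⟩

/-- Used for variables bound by a read: their values then occur as subterms of the message. An
identifier in a function argument would escape the subterm relation. -/
theorem RoleTerm.GroundKeys.subterm_of_mem_ids {m : RoleTerm S} (h : m.GroundKeys) {x : S.Id}
    (hx : x ∈ m.ids) : (RoleTerm.id x).Subterm m := by
  induction m with
  | id y =>
    obtain rfl : x = y := by simpa [RoleTerm.ids] using hx
    exact .refl
  | role r => simp [RoleTerm.ids] at hx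
  | fn f n args => rw [h f n args .refl] at hx; exact hx.elim
  | pair a b iha ihb =>
    rcases hx with hx | hx
    · exact .pairLeft _ _ (iha h.pair.1 hx)
    · exact .pairRight _ _ (ihb h.pair.2 hx)
  | enc a b iha ihb =>
    rcases hx with hx | hx
    · exact .encBody _ _ (iha h.enc.1 hx)
    · exact .encKey _ _ (ihb h.enc.2 hx)

theorem RoleTerm.Subterm.exists_apply {typ : S.Id → Option IdKind} {inst : Inst S}
    {m' m : RoleTerm S} (h : m'.Subterm m) {t : RunTerm S} (ht : inst.apply typ m = some t) :
    ∃ w, w.Subterm t ∧ inst.apply typ m' = some w := by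
  induction h generalizing t with
  | refl => exact ⟨t, .refl, ht⟩
  | pairLeft a b _ ih =>
    obtain ⟨u, v, hu, -, rfl⟩ := Inst.apply_pair_eq_some.1 ht
    obtain ⟨w, h₁, h₂⟩ := ih hu
    exact ⟨w, .pairLeft _ _ h₁, h₂⟩
  | pairRight a b _ ih =>
    obtain ⟨u, v, -, hv, rfl⟩ := Inst.apply_pair_eq_some.1 ht
    obtain ⟨w, h₁, h₂⟩ := ih hv
    exact ⟨w, .pairRight _ _ h₁, h₂⟩
  | encBody a b _ ih =>
    obtain ⟨u, v, hu, -, rfl⟩ := Inst.apply_enc_eq_some.1 ht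
    obtain ⟨w, h₁, h₂⟩ := ih hu
    exact ⟨w, .encBody _ _ h₁, h₂⟩
  | encKey a b _ ih =>
    obtain ⟨u, v, -, hv, rfl⟩ := Inst.apply_enc_eq_some.1 ht
    obtain ⟨w, h₁, h₂⟩ := ih hv
    exact ⟨w, .encKey _ _ h₁, h₂⟩

/-! ### Renaming of nonces -/

open Classical in
/-- Replace the nonces that are generated by the runs in `N` by the intruder term `i`. -/
noncomputable def Nonce.rename (N : Set S.RunId) (i : S.Intruder) : Nonce S → Nonce S
  | .fresh x rid => if rid ∈ N then .intruder i else .fresh x rid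
  | .intruder j => .intruder j

open Classical in
/-- Replace the nonces that are generated by the runs in `N`, and the encryptions in `D`, by the
intruder term `i`; long-term keys are left unchanged. -/
noncomputable def RunTerm.collapse (N : Set S.RunId) (i : S.Intruder) (D : Set (RunTerm S)) :
    RunTerm S → RunTerm S
  | .agent a => .agent a
  | .nonce n => .nonce (n.rename N i)
  | .fn f n args => .fn f n args
  | .pair u v => .pair (u.collapse N i D) (v.collapse N i D)
  | .enc u v =>
    if .enc u v ∈ D then .nonce (.intruder i) else .enc (u.collapse N i D) (v.collapse N i D)

/-- Renaming of the nonces in a run term. -/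
noncomputable def RunTerm.rename (N : Set S.RunId) (i : S.Intruder) : RunTerm S → RunTerm S :=
  RunTerm.collapse N i ∅

theorem RunTerm.rename_pair (N : Set S.RunId) (i : S.Intruder) (u v : RunTerm S) :
    (RunTerm.pair u v).rename N i = .pair (u.rename N i) (v.rename N i) := rfl

theorem RunTerm.rename_enc (N : Set S.RunId) (i : S.Intruder) (u v : RunTerm S) :
    (RunTerm.enc u v).rename N i = .enc (u.rename N i) (v.rename N i) := by
  simp [RunTerm.rename, RunTerm.collapse]

/-- Collapsing leaves function terms alone and turns no other term into a function term, so
decryption survives it. -/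
theorem RunTerm.collapse_inv (N : Set S.RunId) (i : S.Intruder) (D : Set (RunTerm S))
    (v : RunTerm S) : v.inv.collapse N i D = (v.collapse N i D).inv := by
  cases v <;> simp [RunTerm.inv, RunTerm.collapse]
  split <;> rfl

theorem RunTerm.collapse_eq_rename {N : Set S.RunId} {i : S.Intruder} {D : Set (RunTerm S)}
    {t : RunTerm S} (h : ∀ u v, (RunTerm.enc u v).Subterm t → .enc u v ∉ D) :
    t.collapse N i D = t.rename N i := by
  induction t with
  | agent a => rfl
  | nonce n => rfl
  | fn f n args => rfl
  | pair a b iha ihb =>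
    rw [RunTerm.rename_pair, ← iha fun u v h' => h u v (.pairLeft _ _ h'),
      ← ihb fun u v h' => h u v (.pairRight _ _ h')]
    rfl
  | enc a b iha ihb =>
    rw [RunTerm.rename_enc, ← iha fun u v h' => h u v (.encBody _ _ h'),
      ← ihb fun u v h' => h u v (.encKey _ _ h'), RunTerm.collapse, if_neg (h a b .refl)]

/-- Renaming of the values of an instantiation. -/
noncomputable def Inst.rename (N : Set S.RunId) (i : S.Intruder) (inst : Inst S) : Inst S where
  rid := inst.rid
  ρ := inst.ρ
  σ x := (inst.σ x).map (Nonce.rename N i)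

theorem Inst.apply_rename_of_ids_eq_empty (N : Set S.RunId) (i : S.Intruder)
    (typ : S.Id → Option IdKind) (inst : Inst S) {m : RoleTerm S} (h : m.ids = ∅) :
    (inst.rename N i).apply typ m = inst.apply typ m := by
  induction m with
  | id x => simp [RoleTerm.ids] at h
  | role r => rfl
  | fn f n args ih =>
    simp only [RoleTerm.ids, Set.iUnion_eq_empty] at h
    have ih' : ∀ k, (inst.rename N i).apply typ (args k) = inst.apply typ (args k) :=
      fun k => ih k (h k)
    simp only [Inst.apply, ih']
  | pair a b iha ihb =>
    simp only [RoleTerm.ids, Set.union_empty_iff] at h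
    simp only [Inst.apply, iha h.1, ihb h.2]
  | enc a b iha ihb =>
    simp only [RoleTerm.ids, Set.union_empty_iff] at h
    simp only [Inst.apply, iha h.1, ihb h.2]

/-- A run outside `N` keeps its own constants under renaming. Ground keys are needed because
renaming of terms does not enter function arguments, whereas a renamed instantiation would. -/
theorem Inst.apply_rename {N : Set S.RunId} (i : S.Intruder) {typ : S.Id → Option IdKind}
    {inst : Inst S} (hrid : inst.rid ∉ N) {m : RoleTerm S} (h : m.GroundKeys) {t : RunTerm S}
    (ht : inst.apply typ m = some t) :
    (inst.rename N i).apply typ m = some (t.rename N i) := by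
  induction m generalizing t with
  | id x =>
    unfold Inst.apply at ht ⊢
    split at ht
    · obtain rfl := Option.some.inj ht
      simp [RunTerm.rename, RunTerm.collapse, Nonce.rename, Inst.rename, hrid]
    · obtain ⟨n, hn, rfl⟩ := Option.map_eq_some_iff.1 ht
      simp [Inst.rename, hn, RunTerm.rename, RunTerm.collapse]
    · obtain ⟨n, hn, rfl⟩ := Option.map_eq_some_iff.1 ht
      simp [Inst.rename, hn, RunTerm.rename, RunTerm.collapse]
    · cases ht
  | role r =>
    obtain ⟨a, rfl⟩ := Inst.apply_role_eq_some ht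
    exact ht
  | fn f n args =>
    rw [Inst.apply_rename_of_ids_eq_empty N i typ inst (h f n args .refl), ht]
    obtain ⟨a, rfl⟩ := Inst.apply_fn_eq_some ht
    rfl
  | pair a b iha ihb =>
    obtain ⟨u, v, hu, hv, rfl⟩ := Inst.apply_pair_eq_some.1 ht
    exact Inst.apply_pair_eq_some.2 ⟨_, _, iha h.pair.1 hu, ihb h.pair.2 hv, rfl⟩
  | enc a b iha ihb =>
    obtain ⟨u, v, hu, hv, rfl⟩ := Inst.apply_enc_eq_some.1 ht
    exact Inst.apply_enc_eq_some.2
      ⟨_, _, iha h.enc.1 hu, ihb h.enc.2 hv, (RunTerm.rename_enc _ _ _ _).symm⟩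

/-! ### Derivations -/

theorem Derivation.snoc {Ps : Set (Protocol S)} {s s' s'' : State S} {α : Trace S}
    {e : RunEvent S} (h : Derivation Ps s α s') (h' : Step Ps s' e s'') :
    Derivation Ps s (α ++ [e]) s'' := by
  induction h with
  | nil s => exact .cons _ _ _ _ _ h' (.nil _)
  | cons s₁ s₂ s₃ e₁ β h₁ _ ih => exact .cons _ _ _ _ _ h₁ (ih h')

theorem Derivation.exists_of_snoc {Ps : Set (Protocol S)} {s s'' : State S} {α : Trace S}
    {e : RunEvent S} (h : Derivation Ps s (α ++ [e]) s'') :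
    ∃ s', Derivation Ps s α s' ∧ Step Ps s' e s'' := by
  induction α generalizing s with
  | nil =>
    cases h with
    | cons _ s' _ _ _ h₁ h₂ =>
      cases h₂
      exact ⟨s, .nil s, h₁⟩
  | cons e₁ β ih =>
    cases h with
    | cons _ s' _ _ _ h₁ h₂ =>
      obtain ⟨s₂, h₃, h₄⟩ := ih h₂
      exact ⟨s₂, .cons _ _ _ _ _ h₁ h₃, h₄⟩

/-- What holds of every state `s` that is reached by a trace `α`. -/
structure Reached (K₀ : Set (LongTermKey S)) (Ps : Set (Protocol S)) (α : Trace S)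
    (s : State S) : Prop where
  ik : s.IK = knowledge K₀ α
  rid_inj : ∀ R ∈ s.F, ∀ R' ∈ s.F, R.inst.rid = R'.inst.rid → R = R'
  run : ∀ R ∈ s.F, (∃ P ∈ Ps, ∃ r, P r = some R.spec) ∧ R.rest <:+ R.spec.elist ∧
    ∃ e ∈ α, e.spec = R.spec ∧ e.inst = R.inst
  event : ∀ e ∈ α, e.ev ∈ e.spec.elist ∧ ∃ R ∈ s.F, R.spec = e.spec ∧ R.inst.rid = e.inst.rid

theorem mem_replaceRun {F : Set (Run S)} {x y R : Run S} :
    R ∈ replaceRun F x y ↔ R = x ∨ (R ∈ F ∧ R ≠ y) := Iff.rfl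

/-- The common part of end, send, read and claim steps. Only a read changes the instantiation, and
it keeps the run identifier. -/
theorem Reached.replace {K₀ : Set (LongTermKey S)} {Ps : Set (Protocol S)} {α : Trace S}
    {IK IK' : Set (RunTerm S)} {F : Set (Run S)} (h : Reached K₀ Ps α ⟨IK, F⟩)
    {rs : RoleSpec S} {inst inst' : Inst S} {ev : Event S} {rest : List (Event S)}
    (hF : (⟨rs, inst, ev :: rest⟩ : Run S) ∈ F) (hrid : inst'.rid = inst.rid)
    (hIK : IK' = knowledge K₀ (α ++ [⟨rs, inst', ev⟩])) :
    Reached K₀ Ps (α ++ [⟨rs, inst', ev⟩])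
      ⟨IK', replaceRun F ⟨rs, inst', rest⟩ ⟨rs, inst, ev :: rest⟩⟩ where
  ik := hIK
  rid_inj := by
    rintro R (rfl | ⟨hR, hne⟩) R' (rfl | ⟨hR', hne'⟩) heq
    · rfl
    · exact absurd (h.rid_inj _ hR' _ hF (heq.symm.trans hrid)) hne'
    · exact absurd (h.rid_inj _ hR _ hF (heq.trans hrid)) hne
    · exact h.rid_inj _ hR _ hR' heq
  run := by
    rintro R (rfl | ⟨hR, hne⟩)
    · obtain ⟨h₁, h₂, -⟩ := h.run _ hF
      exact ⟨h₁, (List.suffix_cons _ _).trans h₂, _, List.mem_append_right _ (List.mem_singleton.2 rfl), rfl, rfl⟩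
    · obtain ⟨h₁, h₂, e, he, h₃⟩ := h.run _ hR
      exact ⟨h₁, h₂, e, List.mem_append_left _ he, h₃⟩
  event := by
    intro e he
    rcases List.mem_append.1 he with he | he
    · obtain ⟨h₁, R, hR, h₂, h₃⟩ := h.event _ he
      refine ⟨h₁, ?_⟩
      by_cases hRe : R = ⟨rs, inst, ev :: rest⟩
      · subst hRe
        exact ⟨_, Or.inl rfl, h₂, hrid.trans h₃⟩
      · exact ⟨R, Or.inr ⟨hR, hRe⟩, h₂, h₃⟩
    · obtain rfl := List.mem_singleton.1 he
      exact ⟨(h.run _ hF).2.1.subset (by simp), _, Or.inl rfl, rfl, rfl⟩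

theorem Derivation.reached {K₀ : Set (LongTermKey S)} {Ps : Set (Protocol S)} {α : Trace S}
    {s : State S} (h : Derivation Ps ⟨initialKnowledge K₀, ∅⟩ α s) : Reached K₀ Ps α s := by
  induction α using List.reverseRecOn generalizing s with
  | nil =>
    cases h
    exact ⟨rfl, by simp, by simp, by simp⟩
  | append_singleton α e ih =>
    obtain ⟨s', h₁, h₂⟩ := h.exists_of_snoc
    have hs := ih h₁
    cases h₂ with
    | create IK F rs inst l r rest hinit hnew =>
      obtain ⟨P, hP, r', hr', hrest, -, -⟩ := hinit
      refine ⟨?_, ?_, ?_, ?_⟩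
      · rw [knowledge_snoc_of_not_isSend _ _ (by simp [Event.IsSend])]
        exact hs.ik
      · rintro R (rfl | hR) R' (rfl | hR') heq
        · rfl
        · exact absurd heq.symm (hnew _ hR')
        · exact absurd heq (hnew _ hR)
        · exact hs.rid_inj _ hR _ hR' heq
      · rintro R (rfl | hR)
        · refine ⟨⟨P, hP, r', hr'⟩, ?_, _, List.mem_append_right _ (List.mem_singleton.2 rfl), rfl, rfl⟩
          rw [← hrest]
          exact List.suffix_cons _ _
        · obtain ⟨h₁, h₂, e, he, h₃⟩ := hs.run _ hR
          exact ⟨h₁, h₂, e, List.mem_append_left _ he, h₃⟩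
      · intro e he
        rcases List.mem_append.1 he with he | he
        · obtain ⟨h₁, R, hR, h₂⟩ := hs.event _ he
          exact ⟨h₁, R, Or.inr hR, h₂⟩
        · obtain rfl := List.mem_singleton.1 he
          refine ⟨?_, _, Or.inl rfl, rfl, rfl⟩
          change _ ∈ rs.elist
          rw [← hrest]
          simp
    | finish IK F rs inst l r hF =>
      refine hs.replace hF rfl ?_
      rw [knowledge_snoc_of_not_isSend _ _ (by simp [Event.IsSend])]
      exact hs.ik
    | send IK F rs inst l a b m rest t hF ht =>
      refine hs.replace hF rfl ?_
      rw [knowledge_snoc_send _ _ ht, ← hs.ik]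
    | read IK F rs inst inst' l a b m rest t hF ht hm =>
      refine hs.replace hF hm.1 ?_
      rw [knowledge_snoc_of_not_isSend _ _ (by simp [Event.IsSend])]
      exact hs.ik
    | claim IK F rs inst l r cl x rest hF =>
      refine hs.replace hF rfl ?_
      rw [knowledge_snoc_of_not_isSend _ _ (by simp [Event.IsSend])]
      exact hs.ik

/-- Ended runs stay in the state with an empty rest, so a run identifier is never reused and belongs
to one role specification. -/
theorem Reached.spec_eq {K₀ : Set (LongTermKey S)} {Ps : Set (Protocol S)} {α : Trace S}
    {s : State S} (h : Reached K₀ Ps α s) {e e' : RunEvent S} (he : e ∈ α) (he' : e' ∈ α)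
    (hrid : e.inst.rid = e'.inst.rid) : e.spec = e'.spec := by
  obtain ⟨-, R, hR, h₁, h₂⟩ := h.event _ he
  obtain ⟨-, R', hR', h₁', h₂'⟩ := h.event _ he'
  obtain rfl := h.rid_inj _ hR _ hR' (h₂.trans (hrid.trans h₂'.symm))
  exact h₁.symm.trans h₁'

theorem Reached.exists_protocol {K₀ : Set (LongTermKey S)} {Ps : Set (Protocol S)} {α : Trace S}
    {s : State S} (h : Reached K₀ Ps α s) {e : RunEvent S} (he : e ∈ α) :
    ∃ P ∈ Ps, ∃ r, P r = some e.spec := by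
  obtain ⟨-, R, hR, h₁, -⟩ := h.event _ he
  exact h₁ ▸ (h.run _ hR).1

/-- The image under `f` of the runs whose run identifier is not in `N`. -/
def imageRuns (N : Set S.RunId) (f : Run S → Run S) (F : Set (Run S)) : Set (Run S) :=
  f '' {R ∈ F | R.inst.rid ∉ N}

/-- Since `f` keeps run identifiers and these determine the runs in `F`, removing `f y` removes the
image of no other run. -/
theorem imageRuns_replaceRun {N : Set S.RunId} {f : Run S → Run S}
    (hf : ∀ R, (f R).inst.rid = R.inst.rid) {F : Set (Run S)}
    (hF : ∀ R ∈ F, ∀ R' ∈ F, R.inst.rid = R'.inst.rid → R = R') {x y : Run S} (hy : y ∈ F)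
    (hxy : x.inst.rid = y.inst.rid) (hN : y.inst.rid ∉ N) :
    imageRuns N f (replaceRun F x y) = replaceRun (imageRuns N f F) (f x) (f y) := by
  ext R
  rw [mem_replaceRun]
  constructor
  · rintro ⟨R, ⟨rfl | ⟨hR, hne⟩, hRN⟩, rfl⟩
    · exact Or.inl rfl
    · refine Or.inr ⟨⟨R, ⟨hR, hRN⟩, rfl⟩, fun heq => hne (hF _ hR _ hy ?_)⟩
      rw [← hf R, heq, hf]
  · rintro (rfl | ⟨⟨R, ⟨hR, hRN⟩, rfl⟩, hne⟩)
    · exact ⟨x, ⟨Or.inl rfl, hxy ▸ hN⟩, rfl⟩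
    · exact ⟨R, ⟨Or.inr ⟨hR, fun h => hne (h ▸ rfl)⟩, hRN⟩, rfl⟩

theorem imageRuns_insert {N : Set S.RunId} (f : Run S → Run S) (F : Set (Run S)) {x : Run S}
    (hN : x.inst.rid ∉ N) : imageRuns N f (insert x F) = insert (f x) (imageRuns N f F) := by
  ext R
  constructor
  · rintro ⟨R, ⟨rfl | hR, hRN⟩, rfl⟩
    · exact Or.inl rfl
    · exact Or.inr ⟨R, ⟨hR, hRN⟩, rfl⟩
  · rintro (rfl | ⟨R, ⟨hR, hRN⟩, rfl⟩)
    · exact ⟨x, ⟨Or.inl rfl, hN⟩, rfl⟩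
    · exact ⟨R, ⟨Or.inr hR, hRN⟩, rfl⟩

theorem imageRuns_insert_of_mem {N : Set S.RunId} (f : Run S → Run S) (F : Set (Run S))
    {x : Run S} (hN : x.inst.rid ∈ N) : imageRuns N f (insert x F) = imageRuns N f F := by
  ext R
  constructor
  · rintro ⟨R, ⟨rfl | hR, hRN⟩, rfl⟩
    · exact absurd hN hRN
    · exact ⟨R, ⟨hR, hRN⟩, rfl⟩
  · rintro ⟨R, ⟨hR, hRN⟩, rfl⟩
    exact ⟨R, ⟨Or.inr hR, hRN⟩, rfl⟩

theorem imageRuns_replaceRun_of_mem {N : Set S.RunId} (f : Run S → Run S) (F : Set (Run S))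
    {x y : Run S} (hx : x.inst.rid ∈ N) (hy : y.inst.rid ∈ N) :
    imageRuns N f (replaceRun F x y) = imageRuns N f F := by
  rw [replaceRun, imageRuns_insert_of_mem f _ hx]
  ext R
  constructor
  · rintro ⟨R, ⟨⟨hR, -⟩, hRN⟩, rfl⟩
    exact ⟨R, ⟨hR, hRN⟩, rfl⟩
  · rintro ⟨R, ⟨hR, hRN⟩, rfl⟩
    exact ⟨R, ⟨⟨hR, fun h => hRN (h ▸ hy)⟩, hRN⟩, rfl⟩

/-! ### Removing the runs of one of two separated protocol sets -/

/-- In the trace `α`, no encryption that is sent by a run occurs in another run on the other side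
of `N`; messages have ground keys, and the runs in `N` do not send secret long-term keys. -/
structure Separated (K₀ : Set (LongTermKey S)) (N : Set S.RunId) (α : Trace S) : Prop where
  side : ∀ e ∈ α, ∀ e' ∈ α, ∀ (m m' x y x' y' : RoleTerm S) (t : RunTerm S),
    e.ev.IsSend → e.ev.term = some m → e'.ev.term = some m' →
    (RoleTerm.enc x y).Subterm m → (RoleTerm.enc x' y').Subterm m' →
    e.inst.apply e.spec.typ (.enc x y) = some t →
    e'.inst.apply e'.spec.typ (.enc x' y') = some t → (e.inst.rid ∈ N ↔ e'.inst.rid ∈ N)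
  ground : ∀ e ∈ α, ∀ m, e.ev.term = some m → m.GroundKeys
  keys : ∀ e ∈ α, e.inst.rid ∈ N → e.ev.IsSend → ∀ m, e.ev.term = some m → ∀ f n args,
    (RoleTerm.fn f n args).Content m → ∀ t,
    e.inst.apply e.spec.typ (.fn f n args) = some t → ∃ k ∈ K₀, t = k.toTerm

theorem Separated.mono {K₀ : Set (LongTermKey S)} {N : Set S.RunId} {α β : Trace S}
    (h : Separated K₀ N β) (hsub : α ⊆ β) : Separated K₀ N α where
  side e he e' he' := h.side e (hsub he) e' (hsub he')
  ground e he := h.ground e (hsub he)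
  keys e he := h.keys e (hsub he)

theorem Separated.not_subterm {K₀ : Set (LongTermKey S)} {N : Set S.RunId} {α : Trace S}
    (h : Separated K₀ N α) {e e' : RunEvent S} (he : e ∈ α) (he' : e' ∈ α)
    (hside : ¬ (e.inst.rid ∈ N ↔ e'.inst.rid ∈ N)) (hsend : e.ev.IsSend) {m m' : RoleTerm S}
    (hm : e.ev.term = some m) (hm' : e'.ev.term = some m') {t t' : RunTerm S}
    (ht : e.inst.apply e.spec.typ m = some t) (ht' : e'.inst.apply e'.spec.typ m' = some t')
    {u v : RunTerm S} (hu : (RunTerm.enc u v).Subterm t) : ¬ (RunTerm.enc u v).Subterm t' := by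
  intro hu'
  obtain ⟨x, y, h₁, h₂⟩ := hu.exists_enc ht
  obtain ⟨x', y', h₁', h₂'⟩ := hu'.exists_enc ht'
  exact hside (h.side e he e' he' m m' x y x' y' _ hsend hm hm' h₁ h₁' h₂ h₂')

/-- The encryptions that runs in `N` send as content in `α`. -/
def sentEncs (N : Set S.RunId) (α : Trace S) : Set (RunTerm S) :=
  {w | ∃ e ∈ α, e.inst.rid ∈ N ∧ e.ev.IsSend ∧ ∃ m, e.ev.term = some m ∧
    ∃ t, e.inst.apply e.spec.typ m = some t ∧ w.Content t}

/-- Renaming of the nonces in a run event. -/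
noncomputable def RunEvent.rename (N : Set S.RunId) (i : S.Intruder) (e : RunEvent S) :
    RunEvent S :=
  ⟨e.spec, e.inst.rename N i, e.ev⟩

/-- Renaming of the nonces in a run. -/
noncomputable def Run.rename (N : Set S.RunId) (i : S.Intruder) (R : Run S) : Run S :=
  ⟨R.spec, R.inst.rename N i, R.rest⟩

open Classical in
/-- The renamed events of the runs outside `N`. -/
noncomputable def project (N : Set S.RunId) (i : S.Intruder) (α : Trace S) : Trace S :=
  (α.filter fun e => e.inst.rid ∉ N).map (RunEvent.rename N i)

theorem mem_project {N : Set S.RunId} {i : S.Intruder} {α : Trace S} {e : RunEvent S}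
    (he : e ∈ α) (hN : e.inst.rid ∉ N) : e.rename N i ∈ project N i α :=
  List.mem_map_of_mem (List.mem_filter.2 ⟨he, by simpa using hN⟩)

theorem project_snoc_of_notMem {N : Set S.RunId} (i : S.Intruder) (α : Trace S)
    {e : RunEvent S} (hN : e.inst.rid ∉ N) :
    project N i (α ++ [e]) = project N i α ++ [e.rename N i] := by
  simp [project, hN]

theorem project_snoc_of_mem {N : Set S.RunId} (i : S.Intruder) (α : Trace S)
    {e : RunEvent S} (hN : e.inst.rid ∈ N) : project N i (α ++ [e]) = project N i α := by
  simp [project, hN]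

/-- After renaming, the intruder can derive the values of all runs in `N` from the projection. -/
def KnownValues (K₀ : Set (LongTermKey S)) (N : Set S.RunId) (i : S.Intruder) (α : Trace S) :
    Prop :=
  ∀ e ∈ α, e.inst.rid ∈ N → ∀ x v, e.inst.σ x = some v →
    RunTerm.nonce (v.rename N i) ∈ knowledge K₀ (project N i α)

/-! ### Transfer of the intruder knowledge to the projection -/

section

variable {K₀ : Set (LongTermKey S)} {N : Set S.RunId} {i : S.Intruder} {α : Trace S}

/-- Content leaves out encryption keys: an encryption sent by `N` collapses to `i`, so its key need
not be known. Function terms lie in `K₀` by `hsep.keys`, and the nonces are values of the run or its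
own constants, which become `i`. -/
theorem KnownValues.content (hval : KnownValues K₀ N i α) (hsep : Separated K₀ N α)
    {e : RunEvent S} (he : e ∈ α) (hN : e.inst.rid ∈ N) (hsend : e.ev.IsSend)
    {m : RoleTerm S} (hm : e.ev.term = some m) {t : RunTerm S}
    (ht : e.inst.apply e.spec.typ m = some t) {w : RunTerm S} (hw : w.Content t) :
    w.collapse N i (sentEncs N α) ∈ knowledge K₀ (project N i α) := by
  induction w with
  | agent a => exact initialTerms_subset_knowledge _ _ (Or.inl (Or.inl ⟨a, rfl⟩))
  | nonce n =>
    obtain ⟨m', -, h⟩ := hw.exists_roleTerm ht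
    cases m' with
    | id x =>
      rcases Inst.apply_id_eq_some h with ⟨-, h⟩ | ⟨v, hv, h⟩
      · cases h
        simpa [RunTerm.collapse, Nonce.rename, hN] using intruder_mem_knowledge K₀ _ i
      · cases h
        exact hval e he hN x _ hv
    | role r => obtain ⟨_, h⟩ := Inst.apply_role_eq_some h; cases h
    | fn f n args => obtain ⟨_, h⟩ := Inst.apply_fn_eq_some h; cases h
    | pair x y => obtain ⟨_, _, _, _, h⟩ := Inst.apply_pair_eq_some.1 h; cases h
    | enc x y => obtain ⟨_, _, _, _, h⟩ := Inst.apply_enc_eq_some.1 h; cases h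
  | fn f n args =>
    obtain ⟨m', h', h⟩ := hw.exists_roleTerm ht
    cases m' with
    | id x => rcases Inst.apply_id_eq_some h with ⟨_, h⟩ | ⟨_, _, h⟩ <;> cases h
    | role r => obtain ⟨_, h⟩ := Inst.apply_role_eq_some h; cases h
    | fn f' n' args' =>
      obtain ⟨k, hk, hkt⟩ := hsep.keys e he hN hsend m hm _ _ _ h' _ h
      exact initialTerms_subset_knowledge _ _ (Or.inr ⟨k, hk, hkt.symm⟩)
    | pair x y => obtain ⟨_, _, _, _, h⟩ := Inst.apply_pair_eq_some.1 h; cases h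
    | enc x y => obtain ⟨_, _, _, _, h⟩ := Inst.apply_enc_eq_some.1 h; cases h
  | pair u v ihu ihv =>
    have hu := ihu (RunTerm.Content.trans (.pairLeft _ _ .refl) hw)
    have hv := ihv (RunTerm.Content.trans (.pairRight _ _ .refl) hw)
    rw [knowledge_eq] at hu hv ⊢
    exact .pair _ _ hu hv
  | enc u v _ _ =>
    rw [RunTerm.collapse, if_pos ⟨e, he, hN, hsend, m, hm, t, ht, hw⟩]
    exact intruder_mem_knowledge K₀ _ i

/-- Outside `N`, messages and claim arguments contain no encryption sent by runs in `N`. -/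
theorem Separated.collapse_eq_rename (hsep : Separated K₀ N α) {e : RunEvent S} (he : e ∈ α)
    (hN : e.inst.rid ∉ N) {m : RoleTerm S} (hm : e.ev.term = some m) {t : RunTerm S}
    (ht : e.inst.apply e.spec.typ m = some t) {β : Trace S} (hβ : β ⊆ α) :
    t.collapse N i (sentEncs N β) = t.rename N i := by
  refine RunTerm.collapse_eq_rename ?_
  rintro u v huv ⟨e', he', hN', hsend, m', hm', t', ht', hw⟩
  exact hsep.not_subterm (hβ he') he (by simp [hN, hN']) hsend hm' hm ht' ht hw.subterm huv

theorem Separated.rename_mem_sentTerms (hsep : Separated K₀ N α) {e : RunEvent S} (he : e ∈ α)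
    (hN : e.inst.rid ∉ N) (hsend : e.ev.IsSend) {m : RoleTerm S} (hm : e.ev.term = some m)
    {t : RunTerm S} (ht : e.inst.apply e.spec.typ m = some t) :
    t.rename N i ∈ sentTerms (project N i α) :=
  ⟨_, mem_project he hN, m, hsend, hm, Inst.apply_rename i hN (hsep.ground e he m hm) ht⟩

/-- Whatever the intruder knows after `α` is, up to renaming and the encryptions sent by runs in
`N`, known after the projection. -/
theorem KnownValues.collapse_mem (hval : KnownValues K₀ N i α) (hsep : Separated K₀ N α)
    {t : RunTerm S} (ht : t ∈ knowledge K₀ α) :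
    t.collapse N i (sentEncs N α) ∈ knowledge K₀ (project N i α) := by
  have key : ∀ {w t}, w.Content t → t ∈ sentTerms α → (w = t ∨ w ∈ sentEncs N α) →
      w.collapse N i (sentEncs N α) ∈ knowledge K₀ (project N i α) := by
    rintro w t hw ⟨e, he, m, hsend, hm, ht⟩ h
    by_cases hN : e.inst.rid ∈ N
    · exact hval.content hsep he hN hsend hm ht hw
    · rcases h with rfl | ⟨e', he', hN', hsend', m', hm', t', ht', hw'⟩
      -- A message sent outside `N` contains no encryption sent by `N`; its collapse is what the
      -- projected run sends.
      · rw [hsep.collapse_eq_rename he hN hm ht (List.Subset.refl α)]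
        exact sentTerms_subset_knowledge _ _ (hsep.rename_mem_sentTerms he hN hsend hm ht)
      · exact hval.content hsep he' hN' hsend' hm' ht' hw'
  rw [knowledge_eq] at ht
  have hK := knowledge_eq K₀ (project N i α)
  induction (ht : Closure _ t) with
  | mem t h =>
    rcases h with ((⟨a, rfl⟩ | ⟨j, rfl⟩) | ⟨k, hk, rfl⟩) | h
    · exact initialTerms_subset_knowledge _ _ (Or.inl (Or.inl ⟨a, rfl⟩))
    · exact intruder_mem_knowledge K₀ _ j
    · exact initialTerms_subset_knowledge _ _ (Or.inr ⟨k, hk, rfl⟩)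
    · exact key .refl h (Or.inl rfl)
  | enc u v hu hv ihu ihv =>
    -- The intruder may have built an encryption that `N` also sends; then it collapses to `i`.
    rw [RunTerm.collapse]
    split
    · exact intruder_mem_knowledge K₀ _ i
    · rw [hK] at ihu ihv ⊢
      exact .enc _ _ ihu ihv
  | dec u v hu hv ihu ihv =>
    rw [RunTerm.collapse] at ihu
    split at ihu
    · rename_i hD
      obtain ⟨e, he, hN, hsend, m, hm, t, ht, hw⟩ := hD
      exact hval.content hsep he hN hsend hm ht (RunTerm.Content.trans (.encBody _ _ .refl) hw)
    · rw [RunTerm.collapse_inv] at ihv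
      rw [hK] at ihu ihv ⊢
      exact .dec _ _ ihu ihv
  | pair u v hu hv ihu ihv =>
    rw [hK] at ihu ihv ⊢
    exact .pair _ _ ihu ihv
  | fst u v h ih =>
    rw [hK] at ih ⊢
    exact .fst _ _ ih
  | snd u v h ih =>
    rw [hK] at ih ⊢
    exact .snd _ _ ih

/-- Unlike `KnownValues.content`, this reaches nonces inside keys: each one is the value of an
identifier or a constant of the run, wherever it occurs. -/
theorem KnownValues.subterm_nonce_of_sent (hval : KnownValues K₀ N i α) {e : RunEvent S}
    (he : e ∈ α) (hN : e.inst.rid ∈ N) {m : RoleTerm S} {t : RunTerm S}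
    (ht : e.inst.apply e.spec.typ m = some t) {n : Nonce S} (hn : (RunTerm.nonce n).Subterm t) :
    RunTerm.nonce (n.rename N i) ∈ knowledge K₀ (project N i α) := by
  obtain ⟨m', -, h⟩ := hn.exists_roleTerm ht
  cases m' with
  | id x =>
    rcases Inst.apply_id_eq_some h with ⟨-, h⟩ | ⟨v, hv, h⟩
    · cases h
      simpa [Nonce.rename, hN] using intruder_mem_knowledge K₀ _ i
    · cases h
      exact hval e he hN x _ hv
  | role r => obtain ⟨_, h⟩ := Inst.apply_role_eq_some h; cases h
  | fn f n args => obtain ⟨_, h⟩ := Inst.apply_fn_eq_some h; cases h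
  | pair x y => obtain ⟨_, _, _, _, h⟩ := Inst.apply_pair_eq_some.1 h; cases h
  | enc x y => obtain ⟨_, _, _, _, h⟩ := Inst.apply_enc_eq_some.1 h; cases h

/-- A derivable term without encryptions sent outside `N` contains only nonces that are known,
after renaming, from the projection. -/
theorem KnownValues.subterm_nonce (hval : KnownValues K₀ N i α) (hsep : Separated K₀ N α)
    {t : RunTerm S} (ht : t ∈ knowledge K₀ α)
    (hfree : ∀ e ∈ α, e.inst.rid ∉ N → e.ev.IsSend → ∀ m, e.ev.term = some m →
      ∀ t', e.inst.apply e.spec.typ m = some t' →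
      ∀ u v, (RunTerm.enc u v).Subterm t → ¬ (RunTerm.enc u v).Subterm t')
    {n : Nonce S} (hn : (RunTerm.nonce n).Subterm t) :
    RunTerm.nonce (n.rename N i) ∈ knowledge K₀ (project N i α) := by
  induction t with
  | agent a => cases hn
  | nonce n' =>
    cases hn
    exact hval.collapse_mem hsep ht
  | fn f n args => cases hn
  | pair a b iha ihb =>
    rw [knowledge_eq] at ht
    cases hn with
    | pairLeft _ _ hn =>
      refine iha ?_ (fun e he h₁ h₂ m hm t' ht' u v h => hfree e he h₁ h₂ m hm t' ht' u v
        (.pairLeft _ _ h)) hn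
      rw [knowledge_eq]
      exact .fst _ _ ht
    | pairRight _ _ hn =>
      refine ihb ?_ (fun e he h₁ h₂ m hm t' ht' u v h => hfree e he h₁ h₂ m hm t' ht' u v
        (.pairRight _ _ h)) hn
      rw [knowledge_eq]
      exact .snd _ _ ht
  | enc a b iha ihb =>
    have ht' := ht
    rw [knowledge_eq] at ht'
    -- An encryption sent by `N` has only known nonces, even in its key; one sent outside `N` is
    -- excluded by `hfree`; for one built by the intruder, body and key are known and the induction
    -- continues.
    rcases Closure.enc_content ht' .refl with ⟨w, hw, hc⟩ | ⟨ha, hb⟩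
    · rcases hw with ((⟨_, rfl⟩ | ⟨_, rfl⟩) | ⟨_, -, rfl⟩) | ⟨e, he, m, hsend, hm, hw⟩
      · cases hc
      · cases hc
      · cases hc
      · by_cases hN : e.inst.rid ∈ N
        · exact hval.subterm_nonce_of_sent he hN hw (hn.trans hc.subterm)
        · exact absurd hc.subterm (hfree e he hN hsend m hm w hw a b .refl)
    · cases hn with
      | encBody _ _ hn =>
        refine iha ?_ (fun e he h₁ h₂ m hm t' ht' u v h => hfree e he h₁ h₂ m hm t' ht' u v
          (.encBody _ _ h)) hn
        rw [knowledge_eq]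
        exact ha
      | encKey _ _ hn =>
        refine ihb ?_ (fun e he h₁ h₂ m hm t' ht' u v h => hfree e he h₁ h₂ m hm t' ht' u v
          (.encKey _ _ h)) hn
        rw [knowledge_eq]
        exact hb

theorem KnownValues.snoc (hval : KnownValues K₀ N i α) {e : RunEvent S}
    (h : e.inst.rid ∈ N → ∀ x v, e.inst.σ x = some v →
      RunTerm.nonce (v.rename N i) ∈ knowledge K₀ (project N i α)) :
    KnownValues K₀ N i (α ++ [e]) := by
  have hsub : knowledge K₀ (project N i α) ⊆ knowledge K₀ (project N i (α ++ [e])) := by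
    rw [project, project, List.filter_append, List.map_append]
    exact knowledge_mono_append _ _ _
  intro e' he' hN x v hv
  rcases List.mem_append.1 he' with he' | he'
  · exact hsub (hval e' he' hN x v hv)
  · obtain rfl := List.mem_singleton.1 he'
    exact hsub (h hN x v hv)

/-! ### Execution of the projected runs -/

theorem Match.rename {typ : S.Id → Option IdKind} {inst inst' : Inst S} {m : RoleTerm S}
    {t : RunTerm S} (h : Match typ inst m t inst') (i : S.Intruder) (hN : inst.rid ∉ N)
    (hm : m.GroundKeys) :
    Match typ (inst.rename N i) m (t.rename N i) (inst'.rename N i) := by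
  obtain ⟨h₁, h₂, h₃, h₄, h₅⟩ := h
  refine ⟨h₁, h₂, ?_, ?_, Inst.apply_rename i (h₁ ▸ hN) hm h₅⟩
  · intro x v hv
    obtain ⟨w, hw, rfl⟩ := Option.map_eq_some_iff.1 hv
    simp [Inst.rename, h₃ x w hw]
  · simpa [Inst.rename] using h₄

theorem Run.rename_rid (R : Run S) : (R.rename N i).inst.rid = R.inst.rid := rfl

/-- The runs outside `N` can be executed, after renaming, without the runs in `N`. -/
theorem Derivation.project {Qs Rs : Set (Protocol S)} {s : State S}
    (h : Derivation (Qs ∪ Rs) ⟨initialKnowledge K₀, ∅⟩ α s) (hsep : Separated K₀ N α)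
    (hspec : ∀ e ∈ α, e.inst.rid ∉ N → ∀ P ∈ Qs ∪ Rs, ∀ r, P r = some e.spec → P ∈ Qs)
    (hcreate : ∀ β e γ, α = β ++ e :: γ → e.inst.rid ∈ N → (∃ l r, e.ev = .create l r) →
      ∀ x v, e.inst.σ x = some v → RunTerm.nonce v ∈ knowledge K₀ β) :
    Derivation Qs ⟨initialKnowledge K₀, ∅⟩ (project N i α)
      ⟨knowledge K₀ (ProtComp.project N i α), imageRuns N (Run.rename N i) s.F⟩ ∧
    KnownValues K₀ N i α := by
  -- Both conclusions are proved together, because a read outside `N` needs `KnownValues` for the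
  -- prefix.
  induction α using List.reverseRecOn generalizing s with
  | nil =>
    cases h
    refine ⟨?_, by simp [KnownValues]⟩
    have : imageRuns N (Run.rename N i) ∅ = ∅ := by simp [imageRuns]
    rw [this]
    exact .nil _
  | append_singleton α e ih =>
    obtain ⟨s', hα, hstep⟩ := h.exists_of_snoc
    have hsub : α ⊆ α ++ [e] := List.subset_append_left _ _
    have hmem : e ∈ α ++ [e] := by simp
    obtain ⟨hd, hval⟩ := ih hα (hsep.mono hsub) (fun e he => hspec e (hsub he))
      (fun β e' γ hβ => hcreate β e' (γ ++ [e]) (by simp [hβ]))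
    have hr := hα.reached
    -- An active run carries the instantiation of one of its past events, so `KnownValues` covers
    -- it.
    have hvalF : ∀ R ∈ s'.F, R.inst.rid ∈ N → ∀ x v, R.inst.σ x = some v →
        RunTerm.nonce (v.rename N i) ∈ knowledge K₀ (ProtComp.project N i α) := by
      intro R hR hN
      obtain ⟨-, -, e', he', -, h⟩ := hr.run R hR
      rw [← h] at hN ⊢
      exact hval e' he' hN
    by_cases hN : e.inst.rid ∈ N
    · rw [project_snoc_of_mem i α hN]
      have hnew : imageRuns N (Run.rename N i) s.F = imageRuns N (Run.rename N i) s'.F := by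
        cases hstep with
        | create => exact imageRuns_insert_of_mem _ _ hN
        | finish => exact imageRuns_replaceRun_of_mem _ _ hN hN
        | send => exact imageRuns_replaceRun_of_mem _ _ hN hN
        | read IK F rs inst inst' l a b m rest t hF ht hm =>
          exact imageRuns_replaceRun_of_mem _ _ hN (hm.1 ▸ hN)
        | claim => exact imageRuns_replaceRun_of_mem _ _ hN hN
      rw [hnew]
      refine ⟨hd, hval.snoc fun _ => ?_⟩
      cases hstep with
      | create IK F rs inst l r rest hinit hfresh =>
        intro x v hv
        exact hval.collapse_mem (hsep.mono hsub)
          (hcreate α _ [] rfl hN ⟨l, r, rfl⟩ x v hv)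
      | finish IK F rs inst l r hF => exact hvalF _ hF hN
      | send IK F rs inst l a b m rest t hF ht => exact hvalF _ hF hN
      | read IK F rs inst inst' l a b m rest t hF ht hm =>
        intro x v hv
        have hN' : inst.rid ∈ N := hm.1 ▸ hN
        -- A value not present before the read belongs to a variable of the pattern, hence is a
        -- nonce subterm of the message read; by separation this message has no encryption in common
        -- with sends outside `N`.
        by_cases hx : inst.σ x = none
        · have hx' : x ∈ {x | inst'.σ x ≠ none} := by
            change inst'.σ x ≠ none
            rw [hv]
            simp
          rw [hm.2.2.2.1] at hx'
          obtain ⟨hids, hvar⟩ : x ∈ m.ids ∧ rs.typ x = some .var :=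
            hx'.resolve_left fun h => h hx
          have hs := (hsep.ground _ hmem m rfl).subterm_of_mem_ids hids
          obtain ⟨w, hw, hxw⟩ := hs.exists_apply hm.2.2.2.2
          obtain ⟨_, hv', rfl⟩ : ∃ a, inst'.σ x = some a ∧ RunTerm.nonce a = w := by
            simpa [Inst.apply, hvar] using hxw
          obtain rfl := Option.some.inj (hv.symm.trans hv')
          refine hval.subterm_nonce (hsep.mono hsub) (hr.ik ▸ ht) ?_ hw
          intro e he hNe hsend m' hm' t' ht' u v' huv huv'
          exact hsep.not_subterm (hsub he) hmem (by simp [hNe, hN]) hsend hm' rfl ht'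
            hm.2.2.2.2 huv' huv
        · obtain ⟨w, hw⟩ := Option.ne_none_iff_exists'.1 hx
          obtain rfl : w = v := Option.some.inj ((hm.2.2.1 x w hw).symm.trans hv)
          exact hvalF _ hF hN' x w hw
      | claim IK F rs inst l r cl x rest hF => exact hvalF _ hF hN
    · refine ⟨?_, hval.snoc fun h => absurd h hN⟩
      rw [project_snoc_of_notMem i α hN]
      refine hd.snoc ?_
      cases hstep with
      | create IK F rs inst l r rest hinit hfresh =>
        rw [knowledge_snoc_of_not_isSend _ _ (by simp [RunEvent.rename, Event.IsSend]),
          imageRuns_insert _ _ hN]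
        refine .create _ _ _ _ _ _ _ ?_ ?_
        · obtain ⟨P, hP, r', hPr, hrest, hρ, hσ⟩ := hinit
          exact ⟨P, hspec _ hmem hN P hP r' hPr, r', hPr, hrest, hρ, by simpa [Inst.rename] using hσ⟩
        · rintro _ ⟨R, ⟨hR, -⟩, rfl⟩
          exact hfresh R hR
      | finish IK F rs inst l r hF =>
        rw [knowledge_snoc_of_not_isSend _ _ (by simp [RunEvent.rename, Event.IsSend]),
          imageRuns_replaceRun Run.rename_rid hr.rid_inj hF (x := ⟨rs, inst, []⟩) rfl hN]
        exact .finish _ _ _ _ _ _ ⟨_, ⟨hF, hN⟩, rfl⟩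
      | send IK F rs inst l a b m rest t hF ht =>
        have ht' := Inst.apply_rename i hN (hsep.ground _ hmem m rfl) ht
        rw [RunEvent.rename, knowledge_snoc_send _ _ ht',
          imageRuns_replaceRun Run.rename_rid hr.rid_inj hF (x := ⟨rs, inst, rest⟩) rfl hN]
        exact .send _ _ _ _ _ _ _ _ _ _ ⟨_, ⟨hF, hN⟩, rfl⟩ ht'
      | read IK F rs inst inst' l a b m rest t hF ht hm =>
        have hN' : inst.rid ∉ N := hm.1 ▸ hN
        rw [knowledge_snoc_of_not_isSend _ _ (by simp [RunEvent.rename, Event.IsSend]),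
          imageRuns_replaceRun Run.rename_rid hr.rid_inj hF hm.1 hN']
        refine .read _ _ _ _ _ _ _ _ _ _ (t.rename N i) ⟨_, ⟨hF, hN'⟩, rfl⟩ ?_
          (hm.rename i hN' (hsep.ground _ hmem m rfl))
        -- The message is known after the prefix, so the encryptions collapsed are those sent in the
        -- prefix; separation of the longer trace shows that the message contains none of them.
        rw [← hsep.collapse_eq_rename hmem hN rfl hm.2.2.2.2 hsub]
        exact hval.collapse_mem (hsep.mono hsub) (hr.ik ▸ ht)
      | claim IK F rs inst l r cl x rest hF =>
        rw [knowledge_snoc_of_not_isSend _ _ (by simp [RunEvent.rename, Event.IsSend]),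
          imageRuns_replaceRun Run.rename_rid hr.rid_inj hF (x := ⟨rs, inst, rest⟩) rfl hN]
        exact .claim _ _ _ _ _ _ _ _ _ ⟨_, ⟨hF, hN⟩, rfl⟩

end

/-! ### Protocol sets -/

theorem RoleSpec.WellFormed.exists_elist_eq {rs : RoleSpec S} {r : S.Role}
    (h : rs.WellFormed r) :
    ∃ l l' mid, rs.elist = .create l r :: (mid ++ [.finish l' r]) :=
  let ⟨l, l', mid, h', _⟩ := h.shape
  ⟨l, l', mid, h'⟩

theorem mem_protocol_labels {P : Protocol S} {r : S.Role} {rs : RoleSpec S}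
    (h : P r = some rs) {e : Event S} (he : e ∈ rs.elist) : e.label ∈ P.labels :=
  ⟨r, rs, h, e, he, rfl⟩

theorem mem_labels {Ps : Set (Protocol S)} {P : Protocol S} (hP : P ∈ Ps) {l : S.Label}
    (hl : l ∈ P.labels) : l ∈ labels Ps :=
  Set.mem_biUnion hP hl

theorem exists_of_mem_labels {Ps : Set (Protocol S)} {l : S.Label} (hl : l ∈ labels Ps) :
    ∃ P ∈ Ps, l ∈ P.labels := by
  simpa [labels] using hl

/-- The label of the create event fixes the protocol, and the event names the role. Run events
record only a role specification, so the protocol has to be recovered from it. -/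
theorem IsProtocolSet.eq_of_spec {Ps : Set (Protocol S)} (h : IsProtocolSet Ps)
    {P Q : Protocol S} (hP : P ∈ Ps) (hQ : Q ∈ Ps) {r r' : S.Role} {rs : RoleSpec S}
    (hr : P r = some rs) (hr' : Q r' = some rs) : P = Q ∧ r = r' := by
  obtain ⟨l, l', mid, he⟩ := ((h.wellFormed P hP).specs r rs hr).exists_elist_eq
  obtain ⟨k, k', mid', he'⟩ := ((h.wellFormed Q hQ).specs r' rs hr').exists_elist_eq
  have hmem : Event.create l r ∈ rs.elist := by simp [he]
  refine ⟨h.labels_disjoint P hP Q hQ l (mem_protocol_labels hr hmem)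
    (mem_protocol_labels hr' hmem), ?_⟩
  rw [he] at he'
  injection he' with h₁
  injection h₁

theorem RoleSpec.WellFormed.ne_nil_of_suffix {rs : RoleSpec S} {r : S.Role}
    (h : rs.WellFormed r) {e : Event S} {l : List (Event S)} (hl : e :: l <:+ rs.elist)
    (he : ∀ k a, e ≠ .finish k a) : l ≠ [] := by
  rintro rfl
  obtain ⟨k, k', mid, h'⟩ := h.exists_elist_eq
  obtain ⟨t, ht⟩ := hl
  rw [h', ← List.cons_append] at ht
  exact he _ _ (List.append_singleton_inj.1 ht).2

theorem Derivation.create_values {Ps : Set (Protocol S)} {s : State S} {A : Set (RunTerm S)}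
    {α : Trace S} (h : Derivation Ps ⟨A, ∅⟩ α s) {e : RunEvent S} (he : e ∈ α)
    (hc : ∃ l r, e.ev = .create l r) :
    {x | e.inst.σ x ≠ none} = {x | e.spec.typ x = some .param} := by
  induction α using List.reverseRecOn generalizing s with
  | nil => simp at he
  | append_singleton α e' ih =>
    obtain ⟨s', hα, hstep⟩ := h.exists_of_snoc
    rcases List.mem_append.1 he with he | he
    · exact ih hα he
    · obtain rfl := List.mem_singleton.1 he
      obtain ⟨k, a, hc⟩ := hc
      cases hstep with
      | create _ _ _ _ _ _ _ hinit =>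
        obtain ⟨_, _, _, _, _, _, h⟩ := hinit
        exact h
      | finish | send | read | claim => cases hc

/-! ### Adding an event before the end of roles -/

open Classical in
/-- Insert an optional element before the last element of a list. -/
noncomputable def addBeforeLast {β : Type*} (o : Option β) (l : List β) : List β :=
  -- The empty list stays empty: a run that has ended must not receive the inserted event.
  if l = [] then [] else l.dropLast ++ (o.toList ++ l.getLast?.toList)

theorem addBeforeLast_none {β : Type*} (l : List β) : addBeforeLast none l = l := by
  rcases List.eq_nil_or_concat l with rfl | ⟨l, b, rfl⟩ <;> simp [addBeforeLast]

theorem addBeforeLast_singleton {β : Type*} (o : Option β) (b : β) :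
    addBeforeLast o [b] = o.toList ++ [b] := by
  simp [addBeforeLast]

theorem addBeforeLast_cons {β : Type*} (o : Option β) (b : β) {l : List β} (hl : l ≠ []) :
    addBeforeLast o (b :: l) = b :: addBeforeLast o l := by
  simp [addBeforeLast, hl, List.dropLast_cons_of_ne_nil, List.getLast?_cons_of_ne_nil]

/-- `rs` with the event `ex rs` inserted before its end event. -/
noncomputable def RoleSpec.extend (ex : RoleSpec S → Option (Event S)) (rs : RoleSpec S) :
    RoleSpec S :=
  ⟨addBeforeLast (ex rs) rs.elist, rs.typ⟩

/-- The run that corresponds to `R` when role specifications are extended by `ex`. -/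
noncomputable def Run.extend (ex : RoleSpec S → Option (Event S)) (R : Run S) : Run S :=
  ⟨R.spec.extend ex, R.inst, addBeforeLast (ex R.spec) R.rest⟩

/-- The event `e` in the context of the extended role specification. -/
noncomputable def RunEvent.extend (ex : RoleSpec S → Option (Event S)) (e : RunEvent S) :
    RunEvent S :=
  ⟨e.spec.extend ex, e.inst, e.ev⟩

/-- The events that the extended run executes in place of `e`. -/
noncomputable def RunEvent.expand (ex : RoleSpec S → Option (Event S)) (e : RunEvent S) :
    Trace S :=
  match e.ev with
  | .finish _ _ => (ex e.spec).toList.map (⟨e.spec.extend ex, e.inst, ·⟩) ++ [e.extend ex]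
  | _ => [e.extend ex]

/-- The trace in which the extended runs execute also the inserted events. -/
noncomputable def expandTrace (ex : RoleSpec S → Option (Event S)) (α : Trace S) : Trace S :=
  α.flatMap (RunEvent.expand ex)

section

variable {ex : RoleSpec S → Option (Event S)}

theorem RunEvent.extend_mem_expand (e : RunEvent S) : e.extend ex ∈ e.expand ex := by
  unfold RunEvent.expand
  split <;> simp

theorem RunEvent.mem_expand {e e' : RunEvent S} (h : e' ∈ e.expand ex) :
    e' = e.extend ex ∨ ∃ s, ex e.spec = some s ∧ e'.ev = s := by
  unfold RunEvent.expand at h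
  split at h
  · rcases List.mem_append.1 h with h | h
    · obtain ⟨s, hs, rfl⟩ := List.mem_map.1 h
      exact Or.inr ⟨s, by simpa using hs, rfl⟩
    · exact Or.inl (List.mem_singleton.1 h)
  · exact Or.inl (List.mem_singleton.1 h)

theorem RunEvent.expand_of_not_finish {e : RunEvent S} (h : ∀ l r, e.ev ≠ .finish l r) :
    e.expand ex = [e.extend ex] := by
  unfold RunEvent.expand
  split
  · rename_i l r h'
    exact absurd h' (h l r)
  · rfl

theorem RunEvent.mem_expand_of_finish {e : RunEvent S} {l : S.Label} {r : S.Role}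
    (h : e.ev = .finish l r) {s : Event S} (hs : ex e.spec = some s) :
    (⟨e.spec.extend ex, e.inst, s⟩ : RunEvent S) ∈ e.expand ex := by
  simp [RunEvent.expand, h, hs]

theorem extend_mem_expandTrace {α : Trace S} {e : RunEvent S} (he : e ∈ α) :
    e.extend ex ∈ expandTrace ex α :=
  List.mem_flatMap.2 ⟨e, he, e.extend_mem_expand⟩

theorem expandTrace_snoc (α : Trace S) (e : RunEvent S) :
    expandTrace ex (α ++ [e]) = expandTrace ex α ++ e.expand ex := by
  simp [expandTrace]

theorem sentTerms_subset_expandTrace (α : Trace S) :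
    sentTerms α ⊆ sentTerms (expandTrace ex α) := by
  rintro t ⟨e, he, m, h⟩
  exact ⟨_, extend_mem_expandTrace he, m, h⟩

/-- Traces a position in the expanded trace back to the original; `δ` accounts for events that
precede `e'` within the expansion of `e`. -/
theorem exists_of_expandTrace_eq_append {α β γ : Trace S} {e' : RunEvent S}
    (h : expandTrace ex α = β ++ e' :: γ) :
    ∃ α₁ e α₂ δ, α = α₁ ++ e :: α₂ ∧ e' ∈ e.expand ex ∧ β = expandTrace ex α₁ ++ δ := by
  induction α generalizing β with
  | nil => simp [expandTrace] at h
  | cons e α ih =>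
    change e.expand ex ++ expandTrace ex α = _ at h
    rcases List.append_eq_append_iff.1 h with ⟨δ, rfl, h'⟩ | ⟨δ, h₁, h₂⟩
    · obtain ⟨α₁, e₁, α₂, δ', rfl, he, rfl⟩ := ih h'
      exact ⟨e :: α₁, e₁, α₂, δ', rfl, he, by simp [expandTrace]⟩
    · cases δ with
      | nil =>
        simp only [List.nil_append] at h₂
        obtain ⟨α₁, e₁, α₂, δ', rfl, he, hδ⟩ := ih (β := []) h₂.symm
        refine ⟨e :: α₁, e₁, α₂, [], rfl, he, ?_⟩
        have : expandTrace ex α₁ = [] := (List.append_eq_nil_iff.1 hδ.symm).1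
        change β = e.expand ex ++ expandTrace ex α₁ ++ []
        simpa [this] using h₁.symm
      | cons e₁ δ =>
        simp only [List.cons_append, List.cons.injEq] at h₂
        refine ⟨[], e, α, β, rfl, ?_, rfl⟩
        rw [h₁, h₂.1]
        simp

theorem imageRuns_empty_rid_inj {f : Run S → Run S} (hf : ∀ R, (f R).inst.rid = R.inst.rid)
    {F : Set (Run S)} (hF : ∀ R ∈ F, ∀ R' ∈ F, R.inst.rid = R'.inst.rid → R = R') :
    ∀ R ∈ imageRuns ∅ f F, ∀ R' ∈ imageRuns ∅ f F, R.inst.rid = R'.inst.rid → R = R' := by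
  rintro _ ⟨R, ⟨hR, -⟩, rfl⟩ _ ⟨R', ⟨hR', -⟩, rfl⟩ h
  rw [hF R hR R' hR' (by rw [← hf, h, hf])]

/-- The intermediate run `x` must be new, since otherwise its removal would lose a run that was
already there. -/
theorem replaceRun_replaceRun {F : Set (Run S)} {x y z : Run S} (hx : x ∉ F) :
    replaceRun (replaceRun F x y) z x = replaceRun F z y := by
  ext R
  simp only [mem_replaceRun]
  constructor
  · rintro (rfl | ⟨rfl | h, h'⟩)
    · exact Or.inl rfl
    · exact absurd rfl h'
    · exact Or.inr h
  · rintro (rfl | h)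
    · exact Or.inl rfl
    · exact Or.inr ⟨Or.inr h, fun h' => hx (h' ▸ h.1)⟩

theorem Run.extend_cons (rs : RoleSpec S) (inst : Inst S) (e : Event S) {l : List (Event S)}
    (hl : l ≠ []) : Run.extend ex ⟨rs, inst, e :: l⟩ =
      ⟨rs.extend ex, inst, e :: addBeforeLast (ex rs) l⟩ := by
  simp [Run.extend, addBeforeLast_cons _ _ hl]

/-- Traces can be executed with extended role specifications, if the inserted events are send
events that can be executed. -/
theorem Derivation.expand {K₀ : Set (LongTermKey S)} {Ps Qs : Set (Protocol S)} {α : Trace S}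
    {s : State S} (h : Derivation Ps ⟨initialKnowledge K₀, ∅⟩ α s)
    (hwf : ∀ P ∈ Ps, P.WellFormed)
    (hext : ∀ P ∈ Ps, ∀ r rs, P r = some rs →
      ∃ Q ∈ Qs, Q r = some (rs.extend ex) ∧ Q.roles = P.roles)
    (hex : ∀ e ∈ α, (∃ l r, e.ev = .finish l r) → ∀ s, ex e.spec = some s →
      ∃ l a b m t, s = .send l a b m ∧ e.inst.apply e.spec.typ m = some t) :
    Derivation Qs ⟨initialKnowledge K₀, ∅⟩ (expandTrace ex α)
      ⟨knowledge K₀ (expandTrace ex α), imageRuns ∅ (Run.extend ex) s.F⟩ := by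
  induction α using List.reverseRecOn generalizing s with
  | nil =>
    cases h
    have : imageRuns ∅ (Run.extend ex) ∅ = ∅ := by simp [imageRuns]
    rw [this]
    exact .nil _
  | append_singleton α e ih =>
    obtain ⟨s', hα, hstep⟩ := h.exists_of_snoc
    have hd := ih hα (fun e he => hex e (List.mem_append_left _ he))
    have hr := hα.reached
    have hrid : ∀ R : Run S, (R.extend ex).inst.rid = R.inst.rid := fun _ => rfl
    have hne : ∀ {rs inst e l}, (⟨rs, inst, e :: l⟩ : Run S) ∈ s'.F →
        (∀ k a, e ≠ .finish k a) → l ≠ [] := by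
      intro rs inst e l hF he
      obtain ⟨⟨P, hP, r, hPr⟩, hsuf, -⟩ := hr.run _ hF
      exact ((hwf P hP).specs r rs hPr).ne_nil_of_suffix hsuf he
    have himage : ∀ {R}, R ∈ s'.F → R.extend ex ∈ imageRuns ∅ (Run.extend ex) s'.F :=
      fun hR => ⟨_, ⟨hR, id⟩, rfl⟩
    rw [expandTrace_snoc]
    cases hstep with
    | create IK F rs inst l r rest hinit hfresh =>
      rw [RunEvent.expand_of_not_finish (by simp)]
      refine hd.snoc ?_
      rw [knowledge_snoc_of_not_isSend _ _ (by simp [RunEvent.extend, Event.IsSend]),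
        imageRuns_insert _ _ (Set.notMem_empty _)]
      obtain ⟨P, hP, r', hPr, hrest, hρ, hσ⟩ := hinit
      obtain ⟨Q, hQ, hQr, hroles⟩ := hext P hP r' rs hPr
      have hrest' : Event.create l r :: rest = rs.elist := hrest
      have hnil : rest ≠ [] :=
        ((hwf P hP).specs r' rs hPr).ne_nil_of_suffix (e := .create l r)
          (by rw [hrest']) (by simp)
      refine .create _ _ _ _ _ _ _ ⟨Q, hQ, r', hQr, ?_, hρ.trans hroles.symm, hσ⟩ ?_
      · change _ = addBeforeLast (ex rs) rs.elist
        rw [← hrest', addBeforeLast_cons _ _ hnil]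
      · rintro _ ⟨R, ⟨hR, -⟩, rfl⟩
        exact hfresh R hR
    | finish IK F rs inst l r hF =>
      have hnew : imageRuns ∅ (Run.extend ex) (replaceRun F ⟨rs, inst, []⟩
          ⟨rs, inst, [.finish l r]⟩) = replaceRun (imageRuns ∅ (Run.extend ex) F)
            ⟨rs.extend ex, inst, []⟩ ⟨rs.extend ex, inst, (ex rs).toList ++ [.finish l r]⟩ := by
        rw [imageRuns_replaceRun hrid hr.rid_inj hF (x := ⟨rs, inst, []⟩) rfl
          (Set.notMem_empty _)]
        simp [Run.extend, addBeforeLast]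
      have hF' := himage hF
      rw [Run.extend, addBeforeLast_singleton] at hF'
      rw [hnew]
      cases hs : ex rs with
      | none =>
        simp only [hs, Option.toList_none, List.nil_append] at hF' ⊢
        have : RunEvent.expand ex ⟨rs, inst, .finish l r⟩ =
          [⟨rs.extend ex, inst, .finish l r⟩] := by simp [RunEvent.expand, hs, RunEvent.extend]
        rw [this, knowledge_snoc_of_not_isSend _ _ (by simp [Event.IsSend])]
        exact hd.snoc (.finish _ _ _ _ _ _ hF')
      | some s =>
        obtain ⟨k, a, b, m, t, rfl, ht⟩ := hex _ (List.mem_append_right _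
          (List.mem_singleton.2 rfl)) ⟨l, r, rfl⟩ s hs
        simp only [hs, Option.toList_some, List.singleton_append] at hF' ⊢
        have : RunEvent.expand ex ⟨rs, inst, .finish l r⟩ =
          [⟨rs.extend ex, inst, .send k a b m⟩] ++ [⟨rs.extend ex, inst, .finish l r⟩] := by
          simp [RunEvent.expand, hs, RunEvent.extend]
        have ht' : inst.apply (rs.extend ex).typ m = some t := ht
        rw [this, ← List.append_assoc,
          knowledge_snoc_of_not_isSend _ _ (by simp [Event.IsSend]), knowledge_snoc_send _ _ ht']
        -- It would share its run identifier with the run that has yet to execute the inserted send,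
        -- although their remaining events differ.
        have hx : (⟨rs.extend ex, inst, [.finish l r]⟩ : Run S) ∉
            imageRuns ∅ (Run.extend ex) F := by
          intro hx
          have := imageRuns_empty_rid_inj hrid hr.rid_inj _ hx _ hF' rfl
          simp at this
        rw [← replaceRun_replaceRun hx]
        refine (hd.snoc (.send _ _ _ _ _ _ _ _ _ _ hF' ht')).snoc (.finish _ _ _ _ _ _ ?_)
        exact Or.inl rfl
    | send IK F rs inst l a b m rest t hF ht =>
      have hnil := hne hF (by simp)
      have hF' := himage hF
      have ht' : inst.apply (rs.extend ex).typ m = some t := ht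
      rw [Run.extend_cons _ _ _ hnil] at hF'
      rw [RunEvent.expand_of_not_finish (by simp), RunEvent.extend, knowledge_snoc_send _ _ ht',
        imageRuns_replaceRun hrid hr.rid_inj hF (x := ⟨rs, inst, rest⟩) rfl
          (Set.notMem_empty _), Run.extend_cons _ _ _ hnil]
      exact hd.snoc (.send _ _ _ _ _ _ _ _ _ _ hF' ht')
    | read IK F rs inst inst' l a b m rest t hF ht hm =>
      have hnil := hne hF (by simp)
      have hF' := himage hF
      rw [Run.extend_cons _ _ _ hnil] at hF'
      rw [RunEvent.expand_of_not_finish (by simp),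
        knowledge_snoc_of_not_isSend _ _ (by simp [RunEvent.extend, Event.IsSend]),
        imageRuns_replaceRun hrid hr.rid_inj hF (x := ⟨rs, inst', rest⟩) hm.1
          (Set.notMem_empty _), Run.extend_cons _ _ _ hnil]
      refine hd.snoc (.read _ _ _ _ _ _ _ _ _ _ t hF' ?_ hm)
      exact knowledge_mono K₀ (sentTerms_subset_expandTrace α) (hr.ik ▸ ht)
    | claim IK F rs inst l r cl x rest hF =>
      have hnil := hne hF (by simp)
      have hF' := himage hF
      rw [Run.extend_cons _ _ _ hnil] at hF'
      rw [RunEvent.expand_of_not_finish (by simp),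
        knowledge_snoc_of_not_isSend _ _ (by simp [RunEvent.extend, Event.IsSend]),
        imageRuns_replaceRun hrid hr.rid_inj hF (x := ⟨rs, inst, rest⟩) rfl
          (Set.notMem_empty _), Run.extend_cons _ _ _ hnil]
      exact hd.snoc (.claim _ _ _ _ _ _ _ _ _ hF')

end

/-! ### Revealing an identifier -/

open Classical in
/-- The event that `RoleSpec.reveal` inserts. -/
noncomputable def sendReveal (c : S.Id) (r r₀ r₁ : S.Role) (l : S.Label) : Event S :=
  .send l r (if r ≠ r₀ then r₀ else r₁) (.id c)

open Classical in
/-- The event that `revealSet` inserts into a role specification. -/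
noncomputable def revealEvent (Out : Set (Protocol S)) (c : S.Id) (r₀ r₁ : Protocol S → S.Role)
    (lab : Protocol S → S.Role → S.Label) (rs : RoleSpec S) : Option (Event S) :=
  if h : ∃ p : Protocol S × S.Role, p.1 ∈ Out ∧ p.1 p.2 = some rs then
    some (sendReveal c h.choose.2 (r₀ h.choose.1) (r₁ h.choose.1) (lab h.choose.1 h.choose.2))
  else none

section

variable {Ps Out : Set (Protocol S)} {c : S.Id} {r₀ r₁ : Protocol S → S.Role}
  {lab : Protocol S → S.Role → S.Label}

theorem exists_of_revealEvent_eq_some {rs : RoleSpec S} {s : Event S}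
    (h : revealEvent Out c r₀ r₁ lab rs = some s) :
    (∃ P ∈ Out, ∃ r, P r = some rs) ∧ ∃ l a b, s = .send l a b (.id c) := by
  unfold revealEvent at h
  split at h
  · rename_i h'
    obtain ⟨⟨P, r⟩, hP, hr⟩ := h'
    cases h
    exact ⟨⟨P, hP, r, hr⟩, _, _, _, rfl⟩
  · cases h

/-- The protocol and role picked by choice in `revealEvent` are the given ones, because a
specification determines both. -/
theorem revealEvent_of_mem (h : IsProtocolSet Ps) (hOut : Out ⊆ Ps) {P : Protocol S}
    (hP : P ∈ Out) {r : S.Role} {rs : RoleSpec S} (hr : P r = some rs) :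
    ∃ b, revealEvent Out c r₀ r₁ lab rs = some (.send (lab P r) r b (.id c)) ∧
      rs.extend (revealEvent Out c r₀ r₁ lab) = rs.reveal c r (r₀ P) (r₁ P) (lab P r) := by
  have hex : ∃ p : Protocol S × S.Role, p.1 ∈ Out ∧ p.1 p.2 = some rs := ⟨(P, r), hP, hr⟩
  obtain ⟨h₁, h₂⟩ := h.eq_of_spec (hOut hex.choose_spec.1) (hOut hP) hex.choose_spec.2 hr
  have heq : revealEvent Out c r₀ r₁ lab rs =
      some (sendReveal c r (r₀ P) (r₁ P) (lab P r)) := by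
    rw [revealEvent, dif_pos hex, h₁, h₂]
  refine ⟨_, heq, ?_⟩
  obtain ⟨l, l', mid, he⟩ := ((h.wellFormed P (hOut hP)).specs r rs hr).exists_elist_eq
  have hnil : rs.elist ≠ [] := by simp [he]
  rw [RoleSpec.extend, heq, addBeforeLast, if_neg hnil, RoleSpec.reveal]
  rfl

theorem extend_of_notMem (h : IsProtocolSet Ps) (hOut : Out ⊆ Ps) {P : Protocol S}
    (hP : P ∈ Ps) (hPO : P ∉ Out) {r : S.Role} {rs : RoleSpec S} (hr : P r = some rs) :
    rs.extend (revealEvent Out c r₀ r₁ lab) = rs := by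
  cases hs : revealEvent Out c r₀ r₁ lab rs with
  | none => rw [RoleSpec.extend, hs, addBeforeLast_none]
  | some s =>
    obtain ⟨⟨Q, hQ, r', hr'⟩, -⟩ := exists_of_revealEvent_eq_some hs
    obtain ⟨rfl, -⟩ := h.eq_of_spec hP (hOut hQ) hr hr'
    exact absurd hQ hPO

theorem Protocol.reveal_roles (P : Protocol S) (c : S.Id) (r₀ r₁ : S.Role)
    (lab : S.Role → S.Label) : (P.reveal c r₀ r₁ lab).roles = P.roles := by
  simp [Protocol.roles, Protocol.reveal]

/-- Protocol sets whose extension reveals an identifier are disjoint from every set that is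
disjoint from, and compatible with, the extension. -/
theorem notMem_of_disjoint_revealSet {Qs : Set (Protocol S)} (hPs : IsProtocolSet Ps)
    (hset : IsProtocolSet (revealSet Ps Out c r₀ r₁ lab ∪ Qs))
    (hdisj : Disjoint (revealSet Ps Out c r₀ r₁ lab) Qs)
    (hrole : ∀ P ∈ Out, r₀ P ∈ P.roles) {P : Protocol S} (hP : P ∈ Ps) : P ∉ Qs := by
  intro hPQ
  by_cases hPO : P ∈ Out
  · obtain ⟨rs, hrs⟩ := Option.ne_none_iff_exists'.1 (hrole P hPO)
    obtain ⟨l, l', mid, he⟩ := ((hPs.wellFormed P hP).specs _ rs hrs).exists_elist_eq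
    have hmem : P.reveal c (r₀ P) (r₁ P) (lab P) ∈ revealSet Ps Out c r₀ r₁ lab :=
      Or.inl ⟨P, hPO, rfl⟩
    -- `P` and its revealing version share the label of a create event, so they coincide if both lie
    -- in one protocol set.
    have heq := hset.labels_disjoint _ (Or.inl hmem) P (Or.inr hPQ) l
      (mem_protocol_labels (r := r₀ P) (e := .create l (r₀ P)) (by rw [Protocol.reveal, hrs]; rfl)
        (by simp [RoleSpec.reveal, he, List.dropLast_cons_of_ne_nil]))
      (mem_protocol_labels hrs (e := .create l (r₀ P)) (by simp [he]))
    exact Set.disjoint_left.1 hdisj (heq ▸ hmem) hPQ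
  · exact Set.disjoint_left.1 hdisj (Or.inr ⟨hP, hPO⟩) hPQ

theorem exists_extend {Qs : Set (Protocol S)} (hset : IsProtocolSet (Ps ∪ Qs)) (hOut : Out ⊆ Ps)
    {P : Protocol S} (hP : P ∈ Ps ∪ Qs) {r : S.Role} {rs : RoleSpec S} (hr : P r = some rs) :
    ∃ Q ∈ revealSet Ps Out c r₀ r₁ lab ∪ Qs,
      Q r = some (rs.extend (revealEvent Out c r₀ r₁ lab)) ∧ Q.roles = P.roles := by
  have hOut' : Out ⊆ Ps ∪ Qs := hOut.trans Set.subset_union_left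
  by_cases hPO : P ∈ Out
  · obtain ⟨b, -, heq⟩ := revealEvent_of_mem (c := c) (r₀ := r₀) (r₁ := r₁) (lab := lab)
      hset hOut' hPO hr
    refine ⟨P.reveal c (r₀ P) (r₁ P) (lab P), Or.inl (Or.inl ⟨P, hPO, rfl⟩), ?_,
      Protocol.reveal_roles _ _ _ _ _⟩
    rw [heq, Protocol.reveal, hr]
    rfl
  · refine ⟨P, ?_, by rw [extend_of_notMem hset hOut' hP hPO hr]; exact hr, rfl⟩
    exact hP.imp (fun h => Or.inr ⟨h, hPO⟩) id

/-- If the inputs of `In` come from the outputs of `Out`, then they are known to the intruder when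
the outputs are revealed. -/
theorem chiAdversary_expandTrace {K₀ : Set (LongTermKey S)} {In : Set (Protocol S)} {d : S.Id}
    {α : Trace S} {s : State S} (hset : IsProtocolSet Ps) (hOut : Out ⊆ Ps)
    (hα : Reached K₀ Ps α s) (hchi : chiIO Out In c d α) :
    chiAdversary K₀ In d (expandTrace (revealEvent Out c r₀ r₁ lab) α) := by
  intro i e' hi hc
  obtain ⟨hlt, hget⟩ := List.getElem?_eq_some_iff.1 hi
  have hsplit := List.take_append_drop i (expandTrace (revealEvent Out c r₀ r₁ lab) α)
  rw [List.drop_eq_getElem_cons hlt, hget] at hsplit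
  obtain ⟨α₁, e, α₂, δ, rfl, he, hβ⟩ := exists_of_expandTrace_eq_append hsplit.symm
  obtain rfl : e' = e.extend (revealEvent Out c r₀ r₁ lab) := by
    refine (RunEvent.mem_expand he).resolve_right ?_
    rintro ⟨s, hs, hev⟩
    obtain ⟨-, l, a, b, rfl⟩ := exists_of_revealEvent_eq_some hs
    obtain ⟨l', r, hc, -⟩ := hc
    rw [hev] at hc
    cases hc
  have hce : e.IsCreateOf In := hc
  obtain ⟨j, ⟨e₁, hj, ⟨l, hfin, hl⟩, ⟨t, hct, hdt⟩, -⟩, hmin⟩ :=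
    hchi α₁.length e (by simp) hce
  -- The create event belongs to its own set `sameInput`, so its source lies strictly before it.
  have hjlt : j < α₁.length := hmin _ ⟨e, by simp, hce, rfl, fun _ => rfl⟩
  rw [List.getElem?_append_left hjlt] at hj
  have hmem : e₁ ∈ α₁ := List.mem_of_getElem? hj
  refine ⟨t, hdt, ?_⟩
  rw [hβ]
  refine knowledge_mono_append _ _ _ (sentTerms_subset_knowledge _ _ ?_)
  obtain ⟨P, hP, hlP⟩ := exists_of_mem_labels hl
  have hmem' : e₁ ∈ α₁ ++ e :: α₂ := List.mem_append_left _ hmem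
  obtain ⟨Q, hQ, r, hQr⟩ := hα.exists_protocol hmem'
  have hlQ := mem_protocol_labels hQr (hα.event _ hmem').1
  rw [hfin] at hlQ
  obtain rfl := hset.labels_disjoint P (hOut hP) Q hQ l hlP hlQ
  obtain ⟨b, hs, -⟩ := revealEvent_of_mem (c := c) (r₀ := r₀) (r₁ := r₁) (lab := lab)
    hset hOut hP hQr
  exact ⟨_, List.mem_flatMap.2 ⟨e₁, hmem, RunEvent.mem_expand_of_finish hfin hs⟩, .id c,
    trivial, rfl, hct⟩

end

/-! ### Independence -/

/-- The run identifiers of the runs of `Ps` in a trace. -/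
def ridsOf (Ps : Set (Protocol S)) (α : Trace S) : Set S.RunId :=
  {rid | ∃ e ∈ α, e.inst.rid = rid ∧ ∃ P ∈ Ps, ∃ r, P r = some e.spec}

section

variable {K₀ : Set (LongTermKey S)} {Ps Qs : Set (Protocol S)} {α : Trace S} {s : State S}

theorem Reached.rid_mem_ridsOf (h : Reached K₀ Ps α s) {e : RunEvent S} (he : e ∈ α) :
    e.inst.rid ∈ ridsOf Qs α ↔ ∃ P ∈ Qs, ∃ r, P r = some e.spec := by
  constructor
  · rintro ⟨e', he', hrid, h'⟩
    rwa [h.spec_eq he' he hrid] at h'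
  · exact fun h' => ⟨e, he, rfl, h'⟩

theorem Reached.label_mem_labels (h : Reached K₀ (Ps ∪ Qs) α s)
    (hset : IsProtocolSet (Ps ∪ Qs)) {e : RunEvent S} (he : e ∈ α) :
    e.ev.label ∈ labels Qs ↔ e.inst.rid ∈ ridsOf Qs α := by
  rw [h.rid_mem_ridsOf he]
  constructor
  · intro hl
    obtain ⟨P, hP, hlP⟩ := exists_of_mem_labels hl
    obtain ⟨Q, hQ, r, hQr⟩ := h.exists_protocol he
    obtain rfl := hset.labels_disjoint P (Or.inr hP) Q hQ _ hlP
      (mem_protocol_labels hQr (h.event e he).1)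
    exact ⟨P, hP, r, hQr⟩
  · rintro ⟨P, hP, r, hPr⟩
    exact mem_labels hP (mem_protocol_labels hPr (h.event e he).1)

theorem IsProtocolSet.disjoint_labels (hset : IsProtocolSet (Ps ∪ Qs)) (hdisj : Disjoint Ps Qs)
    {l : S.Label} (hl : l ∈ labels Ps) : l ∉ labels Qs := by
  intro hl'
  obtain ⟨P, hP, hlP⟩ := exists_of_mem_labels hl
  obtain ⟨Q, hQ, hlQ⟩ := exists_of_mem_labels hl'
  obtain rfl := hset.labels_disjoint P (Or.inl hP) Q (Or.inr hQ) l hlP hlQ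
  exact Set.disjoint_left.1 hdisj hP hQ

/-- Independence speaks of labels, separation of run identifiers; as the two label sets are
disjoint, the label of an event tells to which side its run belongs. -/
theorem Independent.separated {χ : Trace S → Prop} (hind : Independent K₀ Ps Qs χ)
    (hset : IsProtocolSet (Ps ∪ Qs)) (hα : Derivation (Ps ∪ Qs) ⟨initialKnowledge K₀, ∅⟩ α s)
    (hχ : χ α) (hkeys : ∀ Q ∈ Qs, UsesSecretKeysOnlyAsKeys K₀ Q)
    (hground : ∀ e ∈ α, ∀ m, e.ev.term = some m → m.GroundKeys) :
    Separated K₀ (ridsOf Qs α) α where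
  side e he e' he' m m' x y x' y' t hsend hm hm' hx hx' ht ht' := by
    have hr := hα.reached
    rw [← hr.label_mem_labels hset he, ← hr.label_mem_labels hset he']
    rcases hind.2 α ⟨⟨s, hα⟩, hχ⟩ e he e' he' m m' x y x' y' t hsend hm hm' hx hx' ht ht' with
      ⟨h₁, h₂⟩ | ⟨h₁, h₂⟩
    · exact iff_of_false (hset.disjoint_labels hind.1 h₁) (hset.disjoint_labels hind.1 h₂)
    · exact iff_of_true h₁ h₂
  ground := hground
  keys e he hN hsend m hm f n args hc t ht := by
    have hr := hα.reached
    obtain ⟨Q, hQ, r, hQr⟩ := (hr.rid_mem_ridsOf he).1 hN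
    refine (hkeys Q hQ r _ hQr e.ev (hr.event e he).1 f n args).2 m ?_ hc e.inst t ht
    generalize e.ev = ev at hsend hm
    cases ev <;> first | exact hm | exact hsend.elim

end

end ProtComp

/-! ### Secrecy under passing of values -/

open ProtComp
theorem mainTheorem11 (S : Signature.{u}) [Nonempty S.Intruder] (K₀ : Set (LongTermKey S))
    (P₁ P₂ Out In : Set (Protocol S)) (c d : S.Id)
    (r₀ r₁ : Protocol S → S.Role) (lab : Protocol S → S.Role → S.Label) (l : S.Label)
    -- the requirements on protocol sets (the second one says that the labels `lab` are fresh)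
    (hset : IsProtocolSet (P₁ ∪ P₂))
    (hsetReveal : IsProtocolSet (revealSet P₁ Out c r₀ r₁ lab ∪ P₂))
    (hkeys : ∀ P ∈ P₁ ∪ P₂, UsesSecretKeysOnlyAsKeys K₀ P)
    -- the protocols in `P₁` that output `c`
    (hOut : Out ⊆ P₁) (hOutNonempty : Out.Nonempty)
    (hOutEst : ∀ P ∈ Out, Establishes K₀ P c)
    (hr : ∀ P ∈ Out, r₀ P ∈ P.roles ∧ r₁ P ∈ P.roles ∧ r₀ P ≠ r₁ P)
    -- the protocols in `P₂` that take the input `d`, which is the only parameter in `P₂`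
    (hIn : In ⊆ P₂) (hInParam : ∀ Q ∈ In, HasParam Q d)
    (honly : ∀ Q ∈ P₂, ∀ r rs, Q r = some rs → ∀ x, rs.typ x = some .param → Q ∈ In ∧ x = d)
    (hroles : ∀ P ∈ Out ∪ In, ∀ Q ∈ Out ∪ In, P.roles = Q.roles)
    (hind : Independent K₀ (revealSet P₁ Out c r₀ r₁ lab) P₂ (chiAdversary K₀ In d))
    (hl : IsSecretClaimLabel P₁ l) :
    SatisfiesSecret K₀ (revealSet P₁ Out c r₀ r₁ lab) (fun _ => True) l →
      SatisfiesSecret K₀ (P₁ ∪ P₂) (chiIO Out In c d) l := by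
  rintro hsecret α ⟨⟨s, hα⟩, hchi⟩ e he r m hev
  obtain ⟨i⟩ := ‹Nonempty S.Intruder›
  have hOut' : Out ⊆ P₁ ∪ P₂ := hOut.trans Set.subset_union_left
  have hαr := hα.reached
  -- the trace in which the outputs are revealed
  set ex := revealEvent Out c r₀ r₁ lab
  obtain ⟨s', hα'⟩ : ∃ s', Derivation (revealSet P₁ Out c r₀ r₁ lab ∪ P₂)
      ⟨initialKnowledge K₀, ∅⟩ (expandTrace ex α) s' := by
    refine ⟨_, hα.expand hset.wellFormed (fun P hP r rs h => exists_extend hset hOut hP h) ?_⟩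
    rintro e he ⟨k, r, hfin⟩ s hs
    obtain ⟨⟨P, hP, r', hPr⟩, l', a, b, rfl⟩ := exists_of_revealEvent_eq_some hs
    have hk := mem_protocol_labels hPr (hαr.event e he).1
    rw [hfin] at hk
    -- `Establishes` gives `c` a value at the end event, so the inserted send can be executed there.
    obtain ⟨t, ht⟩ := Option.ne_none_iff_exists'.1
      (hOutEst P hP _ hset (hOut' hP) α ⟨_, hα⟩ e he k r hfin hk)
    exact ⟨l', a, b, _, t, rfl, ht⟩
  have hr' := hα'.reached
  have hadv : chiAdversary K₀ In d (expandTrace ex α) :=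
    chiAdversary_expandTrace hset hOut' hαr hchi
  have hground : ∀ e ∈ expandTrace ex α, ∀ m, e.ev.term = some m → m.GroundKeys := by
    intro e' he' m hm
    obtain ⟨e, he, hee⟩ := List.mem_flatMap.1 he'
    rcases RunEvent.mem_expand hee with rfl | ⟨s, hs, hev⟩
    · obtain ⟨P, hP, r, hPr⟩ := hαr.exists_protocol he
      exact fun f n args =>
        (hkeys P hP r _ hPr e.ev (hαr.event e he).1 f n args).1 m hm
    · obtain ⟨-, l', a, b, rfl⟩ := exists_of_revealEvent_eq_some hs
      rw [hev] at hm
      obtain rfl := Option.some.inj hm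
      rintro f n args ⟨⟩
  have hsep := hind.separated hsetReveal hα' hadv (fun Q hQ => hkeys Q (Or.inr hQ)) hground
  -- the trace without the runs of the second protocol set
  set N := ridsOf P₂ (expandTrace ex α)
  obtain ⟨hβ, hval⟩ := hα'.project (i := i) hsep
    (fun e he hrid P hP r hPr => hP.resolve_right fun hP₂ =>
      hrid ((hr'.rid_mem_ridsOf he).2 ⟨P, hP₂, r, hPr⟩)) (by
    intro β e γ hsplit hrid hcreate x v hv
    have he : e ∈ expandTrace ex α := by simp [hsplit]
    obtain ⟨Q, hQ, r, hQr⟩ := (hr'.rid_mem_ridsOf he).1 hrid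
    have hx : x ∈ {x | e.inst.σ x ≠ none} := by
      change e.inst.σ x ≠ none
      simp [hv]
    -- At creation exactly the parameters have values; in the second set that is `d` alone, which
    -- `chiAdversary` makes known.
    rw [hα'.create_values he hcreate] at hx
    obtain ⟨hQI, rfl⟩ := honly Q hQ r _ hQr x hx
    obtain ⟨k, a, hc⟩ := hcreate
    have hk := mem_protocol_labels hQr (hr'.event e he).1
    rw [hc] at hk
    obtain ⟨t, ht, htK⟩ := hadv β.length e (by simp [hsplit]) ⟨k, a, hc, mem_labels hQI hk⟩
    rw [hsplit, List.take_left] at htK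
    have htyp : e.spec.typ x = some .param := hx
    obtain rfl : RunTerm.nonce v = t := by
      simpa [RunEvent.value, Inst.apply, htyp, hv] using ht
    exact htK)
  -- the claim event in this trace
  have he' : e.extend ex ∈ expandTrace ex α := extend_mem_expandTrace he
  have hrid : e.inst.rid ∉ N := by
    intro hrid
    obtain ⟨P, hP, r', rs, hPr, a, m', hmem⟩ := hl
    obtain ⟨Q, hQ, r'', hQr⟩ := (hr'.rid_mem_ridsOf he').1 hrid
    have hlQ := mem_protocol_labels hQr (hr'.event _ he').1
    have hev' : (e.extend ex).ev = .claim l r .secret (some m) := hev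
    rw [hev'] at hlQ
    obtain rfl := hset.labels_disjoint P (Or.inl hP) Q (Or.inr hQ) l
      (mem_protocol_labels hPr hmem) hlQ
    refine notMem_of_disjoint_revealSet ⟨fun P hP => hset.wellFormed P (Or.inl hP),
      fun P hP Q hQ => hset.labels_disjoint P (Or.inl hP) Q (Or.inl hQ)⟩ hsetReveal hind.1
      (fun P hP => (hr P hP).1) hP hQ
  have hterm : (e.extend ex).ev.term = some m := by
    change e.ev.term = _
    rw [hev]
    rfl
  -- Renaming keeps the assignment of agents to roles, so the alternative about trusted agents
  -- carries over unchanged.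
  refine (hsecret _ ⟨⟨_, hβ⟩, trivial⟩ _ (mem_project he' hrid) r m hev).imp ?_ id
  intro hunknown t ht htK
  refine hunknown (t.rename N i)
    (Inst.apply_rename i hrid (hground _ he' m hterm) ht) ?_
  rw [← hsep.collapse_eq_rename he' hrid hterm ht (List.Subset.refl _)]
  exact hval.collapse_mem hsep (knowledge_mono K₀ (sentTerms_subset_expandTrace α) htK)
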